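/- For $n\ge 1$ let $\delta_n=n(n-1)\cdots 21\in\mathfrak S_n$ be the longest permutation, and let $R(\delta_n)$ be the set of its reduced words, i.e. the words $i_1i_2\cdots i_k$ of minimal length in the letters $1,\dots,n-1$ with $s_{i_1}s_{i_2}\cdots s_{i_k}=\delta_n$, where $s_i=(i,i+1)$. Let $G_{\delta_n}$ be the graph on $R(\delta_n)$ in which two words are joined by an edge if they differ by a single commutation move (exchanging adjacent letters $j,k$ with $|j-k|>1$) or by a single long braid move (exchanging consecutive letters $j(j+1)j$ and $(j+1)j(j+1)$). Let $C_{\delta_n}$ (respectively $B_{\delta_n}$) be the graph obtained from $G_{\delta_n}$ by contracting all edges that come from commutation moves (respectively long braid moves). These graphs are connected, and their diameters $D(n)=\operatorname{diam}(G_{\delta_n})$, $C(n)=\operatorname{diam}(C_{\delta_n})$ and $B(n)=\operatorname{diam}(B_{\delta_n})$ satisfy $D(1)=C(1)=B(1)=0$ and, for all $n\ge 1$, 1. $D(n+1)=D(n)+(n-1)\binom n2$, 2. $C(n+1)=C(n)+\binom n2$, 3. $B(n+1)=B(n)+(n-2)\binom n2$. In particular, $D(n)=\frac{1}{24}\,n(n-1)(n-2)(3n-5)$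 for all $n\ge 1$, which is the value found by Reiner and Roichman and by Assaf. -/

import Mathlib

namespace ReducedWords

/-- The simple reflection `s_i` of the symmetric group on `n` points. Letters and points are
numbered from `0`, so `i` runs over `0, …, n - 2` and `s_i` interchanges `i` and `i + 1`. -/
def simpleReflection {n : ℕ} (i : Fin (n - 1)) : Equiv.Perm (Fin n) :=
  Equiv.swap ⟨i.1, by omega⟩ ⟨i.1 + 1, by omega⟩

/-- The product `s_{i_1} s_{i_2} ⋯ s_{i_k}` belonging to a word `i_1 i_2 … i_k`. -/
def wordProd {n : ℕ} (w : List (Fin (n - 1))) : Equiv.Perm (Fin n) :=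
  (w.map simpleReflection).prod

/-- `w` is a reduced word of `π`: its product is `π`, and no shorter word has this product. -/
def IsReducedWord {n : ℕ} (π : Equiv.Perm (Fin n)) (w : List (Fin (n - 1))) : Prop :=
  wordProd w = π ∧ ∀ v : List (Fin (n - 1)), wordProd v = π → w.length ≤ v.length

/-- The set `R(π)` of reduced words of `π`. -/
abbrev R {n : ℕ} (π : Equiv.Perm (Fin n)) : Type :=
  {w : List (Fin (n - 1)) // IsReducedWord π w}

/-- A commutation move: adjacent letters `j k` with `|j - k| > 1` are exchanged. -/
def CommMove {n : ℕ} (u v : List (Fin (n - 1))) : Prop :=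
  ∃ (x y : List (Fin (n - 1))) (j k : Fin (n - 1)),
    (j.1 + 1 < k.1 ∨ k.1 + 1 < j.1) ∧ u = x ++ [j, k] ++ y ∧ v = x ++ [k, j] ++ y

/-- A long braid move: consecutive letters `j k j` with `|j - k| = 1` are replaced by `k j k`. -/
def BraidMove {n : ℕ} (u v : List (Fin (n - 1))) : Prop :=
  ∃ (x y : List (Fin (n - 1))) (j k : Fin (n - 1)),
    (k.1 = j.1 + 1 ∨ j.1 = k.1 + 1) ∧ u = x ++ [j, k, j] ++ y ∧ v = x ++ [k, j, k] ++ y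

/-- The graph on `R(π)` formed by the commutation edges. -/
def commGraph {n : ℕ} (π : Equiv.Perm (Fin n)) : SimpleGraph (R π) where
  Adj u v := CommMove u.1 v.1
  symm := ⟨by
    rintro u v ⟨x, y, j, k, h, hu, hv⟩
    exact ⟨x, y, k, j, h.symm, hv, hu⟩⟩
  loopless := ⟨by
    rintro u ⟨x, y, j, k, h, hu, hv⟩
    have e := hu.symm.trans hv
    simp at e
    omega⟩

/-- The graph on `R(π)` formed by the long braid edges. -/
def braidGraph {n : ℕ} (π : Equiv.Perm (Fin n)) : SimpleGraph (R π) where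
  Adj u v := BraidMove u.1 v.1
  symm := ⟨by
    rintro u v ⟨x, y, j, k, h, hu, hv⟩
    exact ⟨x, y, k, j, h.symm, hv, hu⟩⟩
  loopless := ⟨by
    rintro u ⟨x, y, j, k, h, hu, hv⟩
    have e := hu.symm.trans hv
    simp at e
    omega⟩

/-- The contraction of the graph `G` along the edges of `H`: the vertices are the connected
components of `H`, and two different components are joined if some edge of `G` runs between them. -/
def contractAlong {V : Type*} (G H : SimpleGraph V) : SimpleGraph H.ConnectedComponent where
  Adj S T := S ≠ T ∧ ∃ u v : V,
    H.connectedComponentMk u = S ∧ H.connectedComponentMk v = T ∧ G.Adj u v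
  symm := ⟨by
    rintro S T ⟨h, u, v, hu, hv, e⟩
    exact ⟨h.symm, v, u, hv, hu, e.symm⟩⟩
  loopless := ⟨fun _ h => h.1 rfl⟩

/-- The graph `G_π` on `R(π)`, with the commutation edges and the long braid edges. -/
def graphG {n : ℕ} (π : Equiv.Perm (Fin n)) : SimpleGraph (R π) :=
  commGraph π ⊔ braidGraph π

/-- The graph `C_π`: `G_π` contracted along the commutation edges. Its vertices are the
commutation classes. -/
def graphC {n : ℕ} (π : Equiv.Perm (Fin n)) : SimpleGraph (commGraph π).ConnectedComponent :=
  contractAlong (graphG π) (commGraph π)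

/-- The graph `B_π`: `G_π` contracted along the long braid edges. Its vertices are the
braid classes. -/
def graphB {n : ℕ} (π : Equiv.Perm (Fin n)) : SimpleGraph (braidGraph π).ConnectedComponent :=
  contractAlong (graphG π) (braidGraph π)

/-- The longest permutation `δ_n = n ⋯ 2 1`. -/
def longest (n : ℕ) : Equiv.Perm (Fin n) := Fin.revPerm

/-- `R(π)` is finite, so that in the connected graphs above the distances are bounded and
`SimpleGraph.diam` is their maximum. -/
instance finite_R {n : ℕ} (π : Equiv.Perm (Fin n)) : Finite (R π) := by
  by_cases h : ∃ w₀, IsReducedWord π w₀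
  · obtain ⟨w₀, h₀⟩ := h
    exact ((List.finite_length_le (Fin (n - 1)) w₀.length).subset
      (fun w (hw : IsReducedWord π w) => hw.2 w₀ h₀.1)).to_subtype
  · have : IsEmpty (R π) := ⟨fun w => h ⟨w.1, w.2⟩⟩
    infer_instance

/-- `D(n) = diam (G_{δ_n})`. -/
noncomputable def D (n : ℕ) : ℕ := (graphG (longest n)).diam

/-- `C(n) = diam (C_{δ_n})`. -/
noncomputable def C (n : ℕ) : ℕ := (graphC (longest n)).diam

/-- `B(n) = diam (B_{δ_n})`. -/
noncomputable def B (n : ℕ) : ℕ := (graphB (longest n)).diam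

end ReducedWords

namespace ReducedWords

/-! Apply the letters of a reduced word of the longest permutation to the positions of the identity
arrangement and record which two values each letter exchanges. Every pair of values crosses exactly
once, so the word becomes a total order on the pairs `(a, b)`, `a < b < n`. This order determines
the word. When `a` and `c` cross they are neighbours, so each `b` between them in size stands to the
left or to the right of both; hence `(a, c)` crosses between `(a, b)` and `(b, c)`
(`isConvexOrder_crossings`). A commutation move exchanges neighbouring disjoint pairs, and a long
braid move reverses three consecutive pairs of a triple.

Two statistics count what is out of order: the triples with `(b, c)` before `(a, b)`, and the pairs
of disjoint pairs in which the one with the larger maximum comes first. A commutation move keeps the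
first and changes the second by at most one; for a braid move the roles are interchanged. The main
combinatorial fact is `IsConvexOrder.exists_lowering_move`: unless both statistics vanish, some move
lowers one of them. The order on which both vanish is unique, and reversing a list replaces both
statistics by their complements, so the same holds for raising.

Thus the sum of the two is a rank function with a unique bottom and a unique top, each reached from
any word by monotone moves. Of the routes between two words through the bottom and through the top,
one has length at most the maximal rank `N`, while bottom and top are at distance at least `N`; so
the diameter is `N` (`connected_and_diam_eq_of_potential`). Contracting one kind of edge makes its
statistic free of charge, and only the other one remains. The diameters of `C`, `B` and `G` are
therefore the number of triples, the number of disjoint pairs of pairs, and their sum; sorting these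
objects by their largest value gives the recursions. -/

/-- The position of `p` in the list `l`. -/
def pos {α : Type*} [DecidableEq α] (l : List α) (p : α) : ℕ :=
  l.idxOf p

/-- `p` occurs before `q` in the list `l`. -/
def Before {α : Type*} [DecidableEq α] (l : List α) (p q : α) : Prop :=
  pos l p < pos l q

instance {α : Type*} [DecidableEq α] (l : List α) (p q : α) : Decidable (Before l p q) :=
  inferInstanceAs (Decidable (_ < _))

/-! ### Relative order in lists and counting of reversed pairs. -/

section Lists

variable {α : Type*} [DecidableEq α]

theorem pos_lt_length {l : List α} {p : α} (h : p ∈ l) : pos l p < l.length :=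
  List.idxOf_lt_length_of_mem h

theorem before_swap_iff {x y : List α} {p q s t : α} (h : (x ++ p :: q :: y).Nodup)
    (h1 : ¬ (s = p ∧ t = q)) (h2 : ¬ (s = q ∧ t = p)) :
    Before (x ++ q :: p :: y) s t ↔ Before (x ++ p :: q :: y) s t := by
  unfold Before pos
  simp only [List.idxOf_append, List.idxOf_cons]
  grind

theorem before_append_left {x y : List α} {p q : α} (h : (x ++ p :: y).Nodup) (hq : q ∈ x) :
    Before (x ++ p :: y) q p := by
  unfold Before pos
  have := List.idxOf_lt_length_of_mem hq
  simp only [List.idxOf_append, List.idxOf_cons]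
  grind

theorem before_append_right {x y : List α} {p q : α} (h : (x ++ p :: y).Nodup) (hq : q ∈ y) :
    Before (x ++ p :: y) p q := by
  unfold Before pos
  simp only [List.idxOf_append, List.idxOf_cons]
  grind

theorem Before.asymm {l : List α} {p q : α} (h : Before l p q) : ¬ Before l q p :=
  Nat.lt_asymm h

theorem before_or_before {l : List α} {p q : α} (hp : p ∈ l) (hpq : p ≠ q) :
    Before l p q ∨ Before l q p := by
  unfold Before pos
  have := (List.idxOf_inj (y := q) hp).not.2 hpq
  omega

theorem before_reverse_iff {l : List α} {p q : α} (h : l.Nodup) (hp : p ∈ l) (hq : q ∈ l)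
    (hpq : p ≠ q) : Before l.reverse p q ↔ Before l q p := by
  obtain ⟨x, y, rfl⟩ := List.append_of_mem hp
  have hr : (y.reverse ++ p :: x.reverse).Nodup := by
    simpa using List.nodup_reverse.2 h
  have e : (x ++ p :: y).reverse = y.reverse ++ p :: x.reverse := by simp
  rw [e]
  rcases List.mem_append.1 hq with hx | hy
  · exact iff_of_true (before_append_right hr (by simpa using hx)) (before_append_left h hx)
  · have hy : q ∈ y := by simpa [hpq.symm] using hy
    exact iff_of_false (before_append_left hr (by simpa using hy)).asymm
      (before_append_right h hy).asymm

/-- The number of pairs `(p, q) ∈ S` that occur in `l` in the order `q`, `p`. -/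
def reversals (S : Finset (α × α)) (l : List α) : ℕ :=
  (S.filter fun e => Before l e.2 e.1).card

theorem reversals_le (S : Finset (α × α)) (l : List α) : reversals S l ≤ S.card :=
  Finset.card_filter_le _ _

/-- Reversing the list turns each pair around, so the counts are complementary. This later derives
every statement about the top from one about the bottom. -/
theorem reversals_reverse {S : Finset (α × α)} {l : List α} (h : l.Nodup)
    (hS : ∀ e ∈ S, e.1 ∈ l ∧ e.2 ∈ l ∧ e.1 ≠ e.2) :
    reversals S l.reverse + reversals S l = S.card := by
  unfold reversals
  rw [← Finset.card_filter_add_card_filter_not (s := S) (fun e => Before l e.2 e.1), add_comm]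
  congr 2
  refine Finset.filter_congr fun e he => ?_
  obtain ⟨h1, h2, h3⟩ := hS e he
  rw [before_reverse_iff h h2 h1 h3.symm]
  constructor
  · exact fun hb => hb.asymm
  · exact (before_or_before h1 h3).resolve_right

theorem reversals_swap_of_notMem {S : Finset (α × α)} {x y : List α} {p q : α}
    (h : (x ++ p :: q :: y).Nodup) (h1 : (p, q) ∉ S) (h2 : (q, p) ∉ S) :
    reversals S (x ++ q :: p :: y) = reversals S (x ++ p :: q :: y) := by
  unfold reversals
  congr 1
  refine Finset.filter_congr fun e he => before_swap_iff h ?_ ?_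
  · rintro ⟨rfl, rfl⟩
    exact h2 he
  · rintro ⟨rfl, rfl⟩
    exact h1 he

/-- Only the relative order of `p` and `q` changes, so the set of reversed pairs gains exactly `(p,
q)`. -/
theorem reversals_swap_of_mem {S : Finset (α × α)} {x y : List α} {p q : α}
    (h : (x ++ p :: q :: y).Nodup) (h1 : (p, q) ∈ S) (h2 : (q, p) ∉ S) :
    reversals S (x ++ q :: p :: y) = reversals S (x ++ p :: q :: y) + 1 := by
  unfold reversals
  have h' : (x ++ q :: p :: y).Nodup := by
    refine (List.Perm.nodup_iff ?_).1 h
    exact (List.Perm.swap q p y).append_left x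
  rw [← Finset.card_insert_of_notMem (a := (p, q))]
  · congr 1
    ext ⟨s, t⟩
    simp only [Finset.mem_filter, Finset.mem_insert, Prod.mk.injEq]
    by_cases e : s = p ∧ t = q
    · obtain ⟨rfl, rfl⟩ := e
      simpa [h1] using before_append_right h' (by simp)
    · by_cases e' : s = q ∧ t = p
      · obtain ⟨rfl, rfl⟩ := e'
        simp only [h2, false_and, or_false, false_iff]
        exact e
      · rw [before_swap_iff h (by tauto) (by tauto)]
        tauto
  · simp only [Finset.mem_filter, not_and]
    exact fun _ => (before_append_right h (by simp)).asymm

theorem pos_append_cons_self {x y : List α} {p : α} (h : (x ++ p :: y).Nodup) :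
    pos (x ++ p :: y) p = x.length := by
  have hp : p ∉ x := fun h' => (List.nodup_append.1 h).2.2 _ h' _ (by simp) rfl
  simp [pos, List.idxOf_append, hp]

theorem pairwise_of_forall_before {l : List α} {r : α → α → Prop} (h : l.Nodup)
    (hr : ∀ p ∈ l, ∀ q ∈ l, Before l p q → r p q) : l.Pairwise r := by
  rw [List.pairwise_iff_getElem]
  intro i j hi hj hij
  refine hr _ (List.getElem_mem hi) _ (List.getElem_mem hj) ?_
  unfold Before pos
  rwa [h.idxOf_getElem, h.idxOf_getElem]

theorem le_of_before {f : α → ℕ} {x y : List α} {p q : α}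
    (hs : x.Pairwise fun p q => f p ≤ f q) (hpq : Before (x ++ y) p q)
    (hq : pos (x ++ y) q < x.length) : f p ≤ f q := by
  have mem : ∀ e, pos (x ++ y) e < x.length → e ∈ x := by
    intro e he
    by_contra hx
    simp [pos, List.idxOf_append, hx] at he
  have hqx := mem q hq
  have hpx := mem p (Nat.lt_trans hpq hq)
  unfold Before pos at hpq
  simp only [List.idxOf_append, hqx, hpx, if_true] at hpq
  have := List.pairwise_iff_getElem.1 hs _ _ (List.idxOf_lt_length_of_mem hpx)
    (List.idxOf_lt_length_of_mem hqx) hpq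
  simpa using this

end Lists

/-- The descent found is the first one, so the whole prefix ending in `p` is sorted. The search for
a lowering move uses this sortedness as well as the descent. -/
theorem pairwise_or_exists_descent {α : Type*} (f : α → ℕ) (l : List α) :
    l.Pairwise (fun p q => f p ≤ f q) ∨ ∃ x p q y, l = x ++ p :: q :: y ∧
      (x ++ [p]).Pairwise (fun p q => f p ≤ f q) ∧ f q < f p := by
  induction l using List.reverseRecOn with
  | nil => simp
  | append_singleton l q ih =>
    rcases ih with h | ⟨x, p, q', y, rfl, h, hd⟩
    · rcases List.eq_nil_or_concat l with rfl | ⟨x, p, rfl⟩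
      · simp
      · simp only [List.concat_eq_append] at h ⊢
        by_cases hd : f q < f p
        · exact Or.inr ⟨x, p, q, [], by simp, h, hd⟩
        · refine Or.inl (List.pairwise_append.2 ⟨h, by simp, ?_⟩)
          intro a ha b hb
          rw [List.mem_singleton.1 hb]
          rcases List.mem_append.1 ha with ha | ha
          · have := (List.pairwise_append.1 h).2.2 a ha p (by simp)
            omega
          · rw [List.mem_singleton.1 ha]
            omega
    · exact Or.inr ⟨x, p, q', y ++ [q], by simp, h, hd⟩

/-! ### The sets of pairs counted by the two statistics, and their sizes. -/

/-- The pairs `a < b < n`. -/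
def pairs (n : ℕ) : Finset (ℕ × ℕ) :=
  (Finset.range n ×ˢ Finset.range n).filter fun p => p.1 < p.2

theorem mem_pairs {n : ℕ} {p : ℕ × ℕ} : p ∈ pairs n ↔ p.1 < p.2 ∧ p.2 < n := by
  simp only [pairs, Finset.mem_filter, Finset.mem_product, Finset.mem_range]
  omega

theorem card_pairs (n : ℕ) : (pairs n).card = n.choose 2 := by
  have : (pairs n).card = ((Finset.range n).sigma Finset.range).card := by
    refine Finset.card_nbij' (fun p => ⟨p.2, p.1⟩) (fun s => (s.2, s.1)) ?_ ?_ ?_ ?_ <;>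
      simp +contextual [Set.MapsTo, Set.LeftInvOn, mem_pairs]
  rw [this, Finset.card_sigma, Nat.choose_two_right]
  simp [Finset.sum_range_id]

/-- The pairs `(a, b)`, `(b, c)` with `a < b < c < n`. -/
def triples (n : ℕ) : Finset ((ℕ × ℕ) × (ℕ × ℕ)) :=
  (pairs n ×ˢ pairs n).filter fun e => e.1.2 = e.2.1

/-- The pairs `(a, b)`, `(c, d)` without a common point, for which `b < d`. -/
def quadruples (n : ℕ) : Finset ((ℕ × ℕ) × (ℕ × ℕ)) :=
  (pairs n ×ˢ pairs n).filter fun e =>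
    e.1.2 < e.2.2 ∧ e.1.1 ≠ e.2.1 ∧ e.1.2 ≠ e.2.1

theorem mem_triples {n a b c d : ℕ} :
    ((a, b), (c, d)) ∈ triples n ↔ a < b ∧ b = c ∧ c < d ∧ d < n := by
  simp only [triples, Finset.mem_filter, Finset.mem_product, mem_pairs]
  omega

theorem mem_quadruples {n a b c d : ℕ} : ((a, b), (c, d)) ∈ quadruples n ↔
    a < b ∧ c < d ∧ b < d ∧ a ≠ c ∧ b ≠ c ∧ d < n := by
  simp only [quadruples, Finset.mem_filter, Finset.mem_product, mem_pairs]
  omega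

theorem card_triples (n : ℕ) : (triples n).card = ∑ c ∈ Finset.range n, c.choose 2 := by
  have : (triples n).card = ((Finset.range n).sigma pairs).card := by
    refine Finset.card_nbij' (fun e => ⟨e.2.2, e.1⟩)
      (fun s => (s.2, (s.2.2, s.1))) ?_ ?_ ?_ ?_
    · rintro ⟨⟨a, b⟩, ⟨c, d⟩⟩ h
      simp only [Finset.mem_coe, mem_triples, Finset.mem_sigma, mem_pairs, Finset.mem_range] at h ⊢
      omega
    · rintro ⟨c, ⟨a, b⟩⟩ h
      simp only [Finset.mem_coe, mem_triples, Finset.mem_sigma, mem_pairs, Finset.mem_range] at h ⊢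
      simp only [true_and]
      omega
    · rintro ⟨⟨a, b⟩, ⟨c, d⟩⟩ h
      simp only [Finset.mem_coe, mem_triples] at h
      simp [h.2.1]
    · rintro ⟨c, ⟨a, b⟩⟩ h
      rfl
  simp [this, Finset.card_sigma, card_pairs]

/-- Classify by the largest value `d`: its partner `c` is any value below `d` outside the other
pair. The truncated `d - 2` is harmless because `d.choose 2` vanishes for `d < 2`. -/
theorem card_quadruples (n : ℕ) :
    (quadruples n).card = ∑ d ∈ Finset.range n, d.choose 2 * (d - 2) := by
  have : (quadruples n).card = ((Finset.range n).sigma fun d =>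
      (pairs d).sigma fun p => Finset.range d \ {p.1, p.2}).card := by
    refine Finset.card_nbij' (fun e => ⟨e.2.2, e.1, e.2.1⟩)
      (fun s => (s.2.1, (s.2.2, s.1))) ?_ ?_ ?_ ?_
    · rintro ⟨⟨a, b⟩, ⟨c, d⟩⟩ h
      simp only [Finset.mem_coe, mem_quadruples, Finset.mem_sigma, mem_pairs, Finset.mem_range,
        Finset.mem_sdiff, Finset.mem_insert, Finset.mem_singleton] at h ⊢
      omega
    · rintro ⟨d, ⟨a, b⟩, c⟩ h
      simp only [Finset.mem_coe, mem_quadruples, Finset.mem_sigma, mem_pairs, Finset.mem_range,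
        Finset.mem_sdiff, Finset.mem_insert, Finset.mem_singleton] at h ⊢
      omega
    · rintro ⟨⟨a, b⟩, ⟨c, d⟩⟩ h
      rfl
    · rintro ⟨d, ⟨a, b⟩, c⟩ h
      rfl
  rw [this, Finset.card_sigma]
  refine Finset.sum_congr rfl fun d _ => ?_
  rw [Finset.card_sigma, ← card_pairs, ← smul_eq_mul]
  refine Finset.sum_const_nat fun p hp => ?_
  have hp := mem_pairs.1 hp
  rw [Finset.card_sdiff_of_subset, Finset.card_pair (by omega), Finset.card_range]
  intro a
  simp only [Finset.mem_insert, Finset.mem_singleton, Finset.mem_range]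
  omega

/-! ### Convex orders of pairs and the effect of moves on the statistics. -/

/-- The lists that occur as crossing sequences of reduced words of the longest permutation: they
enumerate all pairs, and for `a < b < c` the pair `(a, c)` lies between `(a, b)` and `(b, c)`. -/
structure IsConvexOrder (n : ℕ) (l : List (ℕ × ℕ)) : Prop where
  nodup : l.Nodup
  mem_iff : ∀ p, p ∈ l ↔ p ∈ pairs n
  convex : ∀ a b c, a < b → b < c → c < n →
    (Before l (a, b) (a, c) ∧ Before l (a, c) (b, c)) ∨
    (Before l (b, c) (a, c) ∧ Before l (a, c) (a, b))

/-- Two adjacent pairs without a common point are exchanged. -/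
def PairCommMove (l l' : List (ℕ × ℕ)) : Prop :=
  ∃ x y p q, p.1 ≠ q.1 ∧ p.1 ≠ q.2 ∧ p.2 ≠ q.1 ∧ p.2 ≠ q.2 ∧
    l = x ++ p :: q :: y ∧ l' = x ++ q :: p :: y

/-- The consecutive pairs of a triple `a < b < c` are reversed. -/
def PairBraidMove (l l' : List (ℕ × ℕ)) : Prop :=
  ∃ x y a b c, a < b ∧ b < c ∧
    (l = x ++ (a, b) :: (a, c) :: (b, c) :: y ∧ l' = x ++ (b, c) :: (a, c) :: (a, b) :: y ∨
     l' = x ++ (a, b) :: (a, c) :: (b, c) :: y ∧ l = x ++ (b, c) :: (a, c) :: (a, b) :: y)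

theorem PairCommMove.symm {l l' : List (ℕ × ℕ)} (h : PairCommMove l l') : PairCommMove l' l := by
  obtain ⟨x, y, p, q, h1, h2, h3, h4, e, e'⟩ := h
  exact ⟨x, y, q, p, h1.symm, h3.symm, h2.symm, h4.symm, e', e⟩

theorem PairBraidMove.symm {l l' : List (ℕ × ℕ)} (h : PairBraidMove l l') :
    PairBraidMove l' l := by
  obtain ⟨x, y, a, b, c, h1, h2, h⟩ := h
  exact ⟨x, y, a, b, c, h1, h2, h.symm⟩

theorem PairCommMove.reverse {l l' : List (ℕ × ℕ)} (h : PairCommMove l l') :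
    PairCommMove l.reverse l'.reverse := by
  obtain ⟨x, y, p, q, h1, h2, h3, h4, rfl, rfl⟩ := h
  exact ⟨y.reverse, x.reverse, q, p, h1.symm, h3.symm, h2.symm, h4.symm, by simp, by simp⟩

theorem PairBraidMove.reverse {l l' : List (ℕ × ℕ)} (h : PairBraidMove l l') :
    PairBraidMove l.reverse l'.reverse := by
  obtain ⟨x, y, a, b, c, h1, h2, h⟩ := h
  refine ⟨y.reverse, x.reverse, a, b, c, h1, h2, ?_⟩
  rcases h with ⟨rfl, rfl⟩ | ⟨rfl, rfl⟩
  · right; simp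
  · left; simp

theorem PairCommMove.reversals_triples {n : ℕ} {l l' : List (ℕ × ℕ)} (h : PairCommMove l l')
    (hl : l.Nodup) : reversals (triples n) l' = reversals (triples n) l := by
  obtain ⟨x, y, ⟨a, b⟩, ⟨c, d⟩, h1, h2, h3, h4, rfl, rfl⟩ := h
  simp only at h1 h2 h3 h4
  exact reversals_swap_of_notMem hl (by rw [mem_triples]; omega) (by rw [mem_triples]; omega)

theorem PairCommMove.reversals_quadruples {n : ℕ} {l l' : List (ℕ × ℕ)} (h : PairCommMove l l')
    (hl : l.Nodup) :
    reversals (quadruples n) l' ≤ reversals (quadruples n) l + 1 := by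
  obtain ⟨x, y, ⟨a, b⟩, ⟨c, d⟩, h1, h2, h3, h4, rfl, rfl⟩ := h
  have hl' : (x ++ (c, d) :: (a, b) :: y).Nodup :=
    (List.Perm.nodup_iff ((List.Perm.swap _ _ y).append_left x)).1 hl
  by_cases m1 : ((a, b), (c, d)) ∈ quadruples n
  · rw [reversals_swap_of_mem hl m1 (by rw [mem_quadruples] at m1 ⊢; omega)]
  · by_cases m2 : ((c, d), (a, b)) ∈ quadruples n
    · rw [reversals_swap_of_mem hl' m2 m1]
      omega
    · rw [reversals_swap_of_notMem hl m1 m2]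
      omega

section Reversal

variable {α : Type*} [DecidableEq α] {S : Finset (α × α)} {x y : List α} {p q r : α}

/-- The reversal consists of three adjacent exchanges, and the hypotheses leave only that of `p` and
`r` to count. For the consecutive pairs of a triple it counts once in `triples`, and not at all in
`quadruples`, since any two of the three pairs share a point. -/
theorem reversals_reverse_three (h : (x ++ p :: q :: r :: y).Nodup)
    (h1 : (p, q) ∉ S) (h2 : (q, p) ∉ S) (h3 : (q, r) ∉ S) (h4 : (r, q) ∉ S) (h5 : (r, p) ∉ S) :
    reversals S (x ++ r :: q :: p :: y) =
      reversals S (x ++ p :: q :: r :: y) + if (p, r) ∈ S then 1 else 0 := by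
  have e1 : (x ++ q :: p :: r :: y).Nodup :=
    (List.Perm.nodup_iff ((List.Perm.swap _ _ _).append_left x)).1 h
  have e2 : ((x ++ [q]) ++ p :: r :: y).Nodup := by simpa using e1
  have e3 : ((x ++ [q]) ++ r :: p :: y).Nodup :=
    (List.Perm.nodup_iff ((List.Perm.swap _ _ _).append_left _)).1 e2
  have e4 : (x ++ q :: r :: p :: y).Nodup := by simpa using e3
  rw [reversals_swap_of_notMem e4 h3 h4, ← reversals_swap_of_notMem h h1 h2]
  have a1 : x ++ q :: r :: p :: y = (x ++ [q]) ++ r :: p :: y := by simp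
  have a2 : x ++ q :: p :: r :: y = (x ++ [q]) ++ p :: r :: y := by simp
  rw [a1, a2]
  split_ifs with m
  · exact reversals_swap_of_mem e2 m h5
  · exact reversals_swap_of_notMem e2 m h5

end Reversal

theorem reversals_quadruples_braid {n a b c : ℕ} {x y : List (ℕ × ℕ)} (hab : a < b) (hbc : b < c)
    (h : (x ++ (a, b) :: (a, c) :: (b, c) :: y).Nodup) :
    reversals (quadruples n) (x ++ (b, c) :: (a, c) :: (a, b) :: y) =
      reversals (quadruples n) (x ++ (a, b) :: (a, c) :: (b, c) :: y) := by
  rw [reversals_reverse_three h, if_neg, add_zero] <;> rw [mem_quadruples] <;> omega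

theorem reversals_triples_braid {n a b c : ℕ} {x y : List (ℕ × ℕ)} (hab : a < b) (hbc : b < c)
    (hc : c < n) (h : (x ++ (a, b) :: (a, c) :: (b, c) :: y).Nodup) :
    reversals (triples n) (x ++ (b, c) :: (a, c) :: (a, b) :: y) =
      reversals (triples n) (x ++ (a, b) :: (a, c) :: (b, c) :: y) + 1 := by
  rw [reversals_reverse_three h, if_pos] <;> rw [mem_triples] <;> omega

theorem nodup_reverse_three {α : Type*} {x y : List α} {p q r : α}
    (h : (x ++ p :: q :: r :: y).Nodup) : (x ++ r :: q :: p :: y).Nodup := by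
  refine (List.Perm.nodup_iff (List.Perm.append_left x ?_)).1 h
  simpa using (List.reverse_perm [r, q, p]).append_right y

theorem PairBraidMove.reversals_quadruples {n : ℕ} {l l' : List (ℕ × ℕ)} (h : PairBraidMove l l')
    (hl : l.Nodup) : reversals (quadruples n) l' = reversals (quadruples n) l := by
  obtain ⟨x, y, a, b, c, h1, h2, ⟨rfl, rfl⟩ | ⟨rfl, rfl⟩⟩ := h
  · exact reversals_quadruples_braid h1 h2 hl
  · exact (reversals_quadruples_braid h1 h2 (nodup_reverse_three hl)).symm

theorem PairBraidMove.reversals_triples {n : ℕ} {l l' : List (ℕ × ℕ)} (h : PairBraidMove l l')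
    (hl : IsConvexOrder n l) : reversals (triples n) l' ≤ reversals (triples n) l + 1 := by
  obtain ⟨x, y, a, b, c, h1, h2, ⟨rfl, rfl⟩ | ⟨rfl, rfl⟩⟩ := h
  · have hc := (mem_pairs.1 ((hl.mem_iff (b, c)).1 (by simp))).2
    exact (reversals_triples_braid h1 h2 hc hl.nodup).le
  · have hc := (mem_pairs.1 ((hl.mem_iff (b, c)).1 (by simp))).2
    have := reversals_triples_braid h1 h2 hc (nodup_reverse_three hl.nodup)
    omega

/-! ### Lowering moves and the unique order without reversals. -/

namespace IsConvexOrder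

variable {n : ℕ} {l l' : List (ℕ × ℕ)}

theorem reverse (h : IsConvexOrder n l) : IsConvexOrder n l.reverse where
  nodup := List.nodup_reverse.2 h.nodup
  mem_iff p := by rw [List.mem_reverse, h.mem_iff]
  convex a b c hab hbc hc := by
    have m1 : (a, b) ∈ l := (h.mem_iff _).2 (mem_pairs.2 ⟨hab, by simp only; omega⟩)
    have m2 : (a, c) ∈ l := (h.mem_iff _).2 (mem_pairs.2 ⟨by simp only; omega, hc⟩)
    have m3 : (b, c) ∈ l := (h.mem_iff _).2 (mem_pairs.2 ⟨hbc, hc⟩)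
    have n1 : (a, b) ≠ (a, c) := by simp; omega
    have n2 : (a, c) ≠ (b, c) := by simp; omega
    rw [before_reverse_iff h.nodup m1 m2 n1, before_reverse_iff h.nodup m2 m3 n2,
      before_reverse_iff h.nodup m3 m2 n2.symm, before_reverse_iff h.nodup m2 m1 n1.symm]
    have := h.convex a b c hab hbc hc
    tauto

theorem reversals_triples_reverse (h : IsConvexOrder n l) :
    reversals (triples n) l.reverse + reversals (triples n) l = (triples n).card := by
  refine reversals_reverse h.nodup ?_
  rintro ⟨⟨a, b⟩, ⟨c, d⟩⟩ he
  rw [mem_triples] at he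
  simp only [h.mem_iff, mem_pairs, ne_eq, Prod.mk.injEq]
  omega

theorem reversals_quadruples_reverse (h : IsConvexOrder n l) :
    reversals (quadruples n) l.reverse + reversals (quadruples n) l = (quadruples n).card := by
  refine reversals_reverse h.nodup ?_
  rintro ⟨⟨a, b⟩, ⟨c, d⟩⟩ he
  rw [mem_quadruples] at he
  simp only [h.mem_iff, mem_pairs, ne_eq, Prod.mk.injEq]
  omega

theorem mem (h : IsConvexOrder n l) {a b : ℕ} (hab : a < b) (hb : b < n) : (a, b) ∈ l :=
  (h.mem_iff _).2 (mem_pairs.2 ⟨hab, hb⟩)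

/-- Unless all reversal numbers vanish, some move lowers one of them. -/
theorem exists_lowering_move (h : IsConvexOrder n l)
    (hne : ¬ (reversals (triples n) l = 0 ∧ reversals (quadruples n) l = 0)) :
    ∃ l', (PairCommMove l l' ∧ reversals (quadruples n) l' < reversals (quadruples n) l) ∨
      (PairBraidMove l l' ∧ reversals (triples n) l' < reversals (triples n) l) := by
  rcases pairwise_or_exists_descent Prod.snd l with hs | ⟨x, ⟨k, m⟩, ⟨i, j⟩, y, rfl, hs, hd⟩
  -- A list sorted by the larger entries has no reversals: in both sets the second pair has the
  -- larger maximum.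
  · have key : ∀ p ∈ l, ∀ q, p.2 < q.2 → ¬ Before l q p := by
      intro p hp q hpq hb
      have := le_of_before (y := []) hs (by rwa [List.append_nil])
        (by rw [List.append_nil]; exact pos_lt_length hp)
      omega
    refine absurd ⟨?_, ?_⟩ hne
    · rw [reversals, Finset.card_eq_zero, Finset.filter_eq_empty_iff]
      rintro ⟨⟨a, b⟩, ⟨c, d⟩⟩ he
      rw [mem_triples] at he
      exact key _ (h.mem he.1 (by omega)) _ (by simp only; omega)
    · rw [reversals, Finset.card_eq_zero, Finset.filter_eq_empty_iff]
      rintro ⟨⟨a, b⟩, ⟨c, d⟩⟩ he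
      rw [mem_quadruples] at he
      exact key _ (h.mem he.1 (by omega)) _ (by simp only; omega)
  · simp only at hd
    have hkm := mem_pairs.1 ((h.mem_iff (k, m)).1 (by simp))
    have hij := mem_pairs.1 ((h.mem_iff (i, j)).1 (by simp))
    simp only at hkm hij
    -- Since `i < j < m`, the value `m` is neither `i` nor `j`; the neighbours can therefore meet
    -- only through `k`.
    by_cases hdis : k ≠ i ∧ k ≠ j
    · refine ⟨x ++ (i, j) :: (k, m) :: y, Or.inl ⟨?_, ?_⟩⟩
      · exact ⟨x, y, (k, m), (i, j), hdis.1, hdis.2, by simp only; omega, by simp only; omega,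
          rfl, rfl⟩
      · have h' : (x ++ (i, j) :: (k, m) :: y).Nodup :=
          (List.Perm.nodup_iff ((List.Perm.swap _ _ y).append_left x)).1 h.nodup
        rw [reversals_swap_of_mem h']
        · omega
        · rw [mem_quadruples]; omega
        · rw [mem_quadruples]; omega
    · have idx1 : pos (x ++ (k, m) :: (i, j) :: y) (k, m) = x.length :=
        pos_append_cons_self h.nodup
      have idx2 : pos (x ++ (k, m) :: (i, j) :: y) (i, j) = x.length + 1 := by
        have := h.nodup
        rw [List.append_cons] at this ⊢
        simpa using pos_append_cons_self this
      have sorted : ∀ p q, Before (x ++ (k, m) :: (i, j) :: y) p q →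
          pos (x ++ (k, m) :: (i, j) :: y) q ≤ x.length → p.2 ≤ q.2 := by
        intro p q hpq hq
        rw [List.append_cons] at hpq hq
        exact le_of_before hs hpq (by simpa using Nat.lt_succ_of_le hq)
      have order := h.convex i j m hij.1 hd hkm.2
      unfold Before at order
      -- If `k = j`, then `(i, m)` would have to lie between the neighbours `(j, m)` and `(i, j)`.
      by_cases hkj : k = j
      · subst hkj
        omega
      obtain rfl : k = i := by tauto
      -- With `k = i`, convexity puts `(j, m)` before `(k, m)`, so there is an entry just before
      -- `(k, m)`. If it is `(j, m)`, a braid move applies; any other entry will contradict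
      -- convexity.
      have hx : x ≠ [] := by
        rintro rfl
        simp only [List.length_nil] at idx1 idx2
        omega
      obtain ⟨x', ⟨k', m'⟩, rfl⟩ : ∃ x' e, x = x' ++ [e] :=
        ⟨x.dropLast, x.getLast hx, (List.dropLast_append_getLast hx).symm⟩
      have e : (x' ++ [(k', m')]) ++ (k, m) :: (k, j) :: y =
        x' ++ (k', m') :: (k, m) :: (k, j) :: y := by simp
      rw [e] at h idx1 idx2 sorted order ⊢
      have idx3 : pos (x' ++ (k', m') :: (k, m) :: (k, j) :: y) (k', m') = x'.length :=
        pos_append_cons_self h.nodup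
      simp only [List.length_append, List.length_singleton] at idx1 idx2 sorted
      have hk' := mem_pairs.1 ((h.mem_iff (k', m')).1 (by simp))
      have hjm := h.mem hd hkm.2
      simp only at hk'
      by_cases hj : (k', m') = (j, m)
      · simp only [Prod.mk.injEq] at hj
        obtain ⟨rfl, rfl⟩ := hj
        refine ⟨x' ++ (k, k') :: (k, m') :: (k', m') :: y, Or.inr ⟨?_, ?_⟩⟩
        · exact ⟨x', y, k, k', m', hij.1, hd, Or.inr ⟨rfl, rfl⟩⟩
        · rw [reversals_triples_braid hij.1 hd hkm.2 (nodup_reverse_three h.nodup)]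
          omega
      · exfalso
        have hne := before_or_before (h.mem hk'.1 hk'.2) hj
        unfold Before at hne
        -- The entry `(k', m')` lies between `(j, m)` and `(k, m)` in the sorted prefix, which
        -- forces `m' = m`.
        have s1 := sorted (j, m) (k', m') (by unfold Before; omega) (by omega)
        have s2 := sorted (k', m') (k, m) (by unfold Before; omega) (by omega)
        simp only at s1 s2
        obtain rfl : m = m' := le_antisymm s1 s2
        have outside : ∀ p, p.2 < m →
            ¬ (Before (x' ++ (k', m) :: (k, m) :: (k, j) :: y) (j, m) p ∧
              pos (x' ++ (k', m) :: (k, m) :: (k, j) :: y) p ≤ x'.length + 1) := by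
          rintro p hp ⟨hb, hle⟩
          have := sorted _ _ hb hle
          simp only at this
          omega
        have hkk : k' ≠ k := by
          rintro rfl
          omega
        have hjk : j ≠ k' := by
          rintro rfl
          exact hj rfl
        generalize (x' ++ (k', m) :: (k, m) :: (k, j) :: y) = l at *
        unfold Before at outside
        -- In each ordering of `k`, `j`, `k'`, convexity of the triples containing `m` fixes on
        -- which side of the known entries the pairs formed with `k'` lie. Convexity of the triple
        -- made of `k`, `j` and `k'` then requires a pair strictly between `(k, m)` and `(k, j)`,
        -- but these are adjacent.
        rcases lt_or_gt_of_ne hjk with hlt | hlt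
        · have c1 := h.convex j k' m hlt hk'.1 hkm.2
          have c2 := h.convex k k' m (by omega) hk'.1 hkm.2
          have c3 := h.convex k j k' hij.1 hlt (by omega)
          have o1 := outside (j, k') hk'.1
          have o2 := outside (k, k') hk'.1
          unfold Before at c1 c2 c3
          omega
        · have c1 := h.convex k' j m hlt hd hkm.2
          have o1 := outside (k', j) hd
          unfold Before at c1
          rcases lt_or_gt_of_ne hkk with hlt' | hlt'
          · have c2 := h.convex k' k m hlt' hkm.1 hkm.2
            have c3 := h.convex k' k j hlt' hij.1 (by omega)
            have o2 := outside (k', k) hkm.1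
            unfold Before at c2 c3
            omega
          · have c2 := h.convex k k' m hlt' hk'.1 hkm.2
            have c3 := h.convex k k' j hlt' hlt (by omega)
            have o2 := outside (k, k') hk'.1
            unfold Before at c2 c3
            omega

/-- The order without reversals is unique. -/
theorem before_iff_of_reversals_eq_zero (h : IsConvexOrder n l)
    (h3 : reversals (triples n) l = 0) (h4 : reversals (quadruples n) l = 0)
    {p q : ℕ × ℕ} (hp : p ∈ pairs n) (hq : q ∈ pairs n)
    (hpq : p.2 < q.2 ∨ p.2 = q.2 ∧ p.1 < q.1) : Before l p q := by
  rw [reversals, Finset.card_eq_zero, Finset.filter_eq_empty_iff] at h3 h4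
  obtain ⟨a, b⟩ := p
  obtain ⟨c, d⟩ := q
  have hl : (a, b) ∈ l := (h.mem_iff _).2 hp
  have hne : (a, b) ≠ (c, d) := by
    rintro e
    simp only [Prod.mk.injEq] at e
    simp only at hpq
    omega
  refine (before_or_before hl hne).resolve_right fun hb => ?_
  rw [mem_pairs] at hp hq
  simp only at hp hq hpq
  -- Disjoint pairs with different maxima are ordered by `h4`. All other pairs share a point, and
  -- for these convexity together with `h3` leaves only the lexicographic order of the triple.
  have key : ∀ i j m, i < j → j < m → m < n →
      Before l (i, j) (i, m) ∧ Before l (i, m) (j, m) := by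
    intro i j m hij hjm hm
    refine (h.convex i j m hij hjm hm).resolve_right fun hc => ?_
    exact h3 (x := ((i, j), (j, m))) (by rw [mem_triples]; omega)
      (lt_trans hc.1 hc.2)
  unfold Before at key hb
  by_cases hdis : b < d ∧ a ≠ c ∧ b ≠ c
  · exact h4 (x := ((a, b), (c, d))) (by rw [mem_quadruples]; omega) hb
  · rcases hpq with hbd | ⟨rfl, hac⟩
    · by_cases hac : a = c
      · subst hac
        have := key a b d hp.1 hbd hq.2
        omega
      · obtain rfl : b = c := by tauto
        have := key a b d hp.1 hbd hq.2
        omega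
    · have := key a c b hac hq.1 hq.2
      omega

theorem eq_of_reversals_eq_zero (h : IsConvexOrder n l) (h' : IsConvexOrder n l')
    (h3 : reversals (triples n) l = 0) (h4 : reversals (quadruples n) l = 0)
    (h3' : reversals (triples n) l' = 0) (h4' : reversals (quadruples n) l' = 0) : l = l' := by
  have hperm : l.Perm l' :=
    (List.perm_ext_iff_of_nodup h.nodup h'.nodup).2 fun p => by rw [h.mem_iff, h'.mem_iff]
  have sorted : ∀ l : List (ℕ × ℕ), IsConvexOrder n l → reversals (triples n) l = 0 →
      reversals (quadruples n) l = 0 →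
      l.Pairwise fun p q => p.2 < q.2 ∨ p.2 = q.2 ∧ p.1 < q.1 := by
    intro l h h3 h4
    refine pairwise_of_forall_before h.nodup fun p hp q hq hb => ?_
    by_contra hn
    have hne : p ≠ q := by
      rintro rfl
      exact lt_irrefl _ hb
    have : q.2 < p.2 ∨ q.2 = p.2 ∧ q.1 < p.1 := by
      have : ¬ (p.1 = q.1 ∧ p.2 = q.2) := fun e => hne (Prod.ext e.1 e.2)
      omega
    exact hb.asymm
      (h.before_iff_of_reversals_eq_zero h3 h4 ((h.mem_iff _).1 hq) ((h.mem_iff _).1 hp) this)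
  refine hperm.eq_of_pairwise (fun p q _ _ h1 h2 => ?_) (sorted l h h3 h4) (sorted l' h' h3' h4')
  omega

end IsConvexOrder

/-! ### Words, their crossing sequences, and reducedness. -/

section Words

variable {n : ℕ}

/-- The left one of the two adjacent positions exchanged by the letter `i`. -/
def leftPos (i : Fin (n - 1)) : Fin n := ⟨i.1, by omega⟩

/-- The right one of the two adjacent positions exchanged by the letter `i`. -/
def rightPos (i : Fin (n - 1)) : Fin n := ⟨i.1 + 1, by omega⟩

theorem simpleReflection_eq (i : Fin (n - 1)) :
    simpleReflection i = Equiv.swap (leftPos i) (rightPos i) := rfl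

/-- The pairs of values that are exchanged when the letters of a word are applied to the
positions, one after the other, starting with the arrangement `σ`. -/
def crossings (σ : Equiv.Perm (Fin n)) : List (Fin (n - 1)) → List (ℕ × ℕ)
  | [] => []
  | i :: w => ((σ (leftPos i)).1, (σ (rightPos i)).1) :: crossings (σ * simpleReflection i) w

theorem perm_inv_apply_self (σ : Equiv.Perm (Fin n)) (a : Fin n) : σ⁻¹ (σ a) = a :=
  σ.symm_apply_apply a

theorem wordProd_nil : wordProd ([] : List (Fin (n - 1))) = 1 := rfl

theorem wordProd_cons (i : Fin (n - 1)) (w : List (Fin (n - 1))) :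
    wordProd (i :: w) = simpleReflection i * wordProd w := by
  simp [wordProd]

theorem wordProd_append (u v : List (Fin (n - 1))) :
    wordProd (u ++ v) = wordProd u * wordProd v := by
  simp [wordProd]

theorem crossings_append (σ : Equiv.Perm (Fin n)) (u v : List (Fin (n - 1))) :
    crossings σ (u ++ v) = crossings σ u ++ crossings (σ * wordProd u) v := by
  induction u generalizing σ with
  | nil => simp [crossings, wordProd_nil]
  | cons i u ih => simp [crossings, wordProd_cons, ih, mul_assoc]

theorem length_crossings (σ : Equiv.Perm (Fin n)) (w : List (Fin (n - 1))) :
    (crossings σ w).length = w.length := by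
  induction w generalizing σ with
  | nil => rfl
  | cons i w ih => simp [crossings, ih]

theorem crossings_injective (σ : Equiv.Perm (Fin n)) : Function.Injective (crossings σ) := by
  intro u v h
  induction u generalizing σ v with
  | nil =>
    have := congrArg List.length h
    simp only [length_crossings, List.length_nil] at this
    exact (List.length_eq_zero_iff.1 this.symm).symm
  | cons i u ih =>
    cases v with
    | nil => simp [crossings] at h
    | cons j v =>
      simp only [crossings, List.cons.injEq, Prod.mk.injEq] at h
      have e := σ.injective (Fin.ext h.1.1)
      obtain rfl : i = j := Fin.ext (by simpa [leftPos] using e)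
      rw [ih _ h.2]

theorem exists_of_crossings_eq_append {σ : Equiv.Perm (Fin n)} {w : List (Fin (n - 1))}
    {x y : List (ℕ × ℕ)} (h : crossings σ w = x ++ y) :
    ∃ u v, w = u ++ v ∧ crossings σ u = x ∧ crossings (σ * wordProd u) v = y := by
  have hl := congrArg List.length h
  rw [length_crossings, List.length_append] at hl
  refine ⟨w.take x.length, w.drop x.length, (List.take_append_drop _ _).symm, ?_⟩
  rw [← List.take_append_drop x.length w, crossings_append] at h
  refine List.append_inj h ?_
  rw [length_crossings, List.length_take]
  omega

theorem exists_of_crossings_eq_cons {σ : Equiv.Perm (Fin n)} {w : List (Fin (n - 1))}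
    {p : ℕ × ℕ} {y : List (ℕ × ℕ)} (h : crossings σ w = p :: y) :
    ∃ i v, w = i :: v ∧ ((σ (leftPos i)).1, (σ (rightPos i)).1) = p ∧
      crossings (σ * simpleReflection i) v = y := by
  cases w with
  | nil => simp [crossings] at h
  | cons i v =>
    simp only [crossings, List.cons.injEq] at h
    exact ⟨i, v, rfl, h.1, h.2⟩

/-- Here `σ⁻¹ a` is the position of the value `a`. Exchanging the contents of two adjacent positions
affects the relative position of those two values only. -/
theorem inv_mul_simpleReflection_lt_iff (σ : Equiv.Perm (Fin n)) (i : Fin (n - 1)) {a b : Fin n}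
    (h1 : (a, b) ≠ (σ (leftPos i), σ (rightPos i)))
    (h2 : (b, a) ≠ (σ (leftPos i), σ (rightPos i))) :
    (σ * simpleReflection i)⁻¹ a < (σ * simpleReflection i)⁻¹ b ↔ σ⁻¹ a < σ⁻¹ b := by
  obtain ⟨a, rfl⟩ := σ.surjective a
  obtain ⟨b, rfl⟩ := σ.surjective b
  have h1 : ¬ (a = leftPos i ∧ b = rightPos i) := by
    rintro ⟨rfl, rfl⟩
    exact h1 rfl
  have h2 : ¬ (b = leftPos i ∧ a = rightPos i) := by
    rintro ⟨rfl, rfl⟩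
    exact h2 rfl
  rw [mul_inv_rev, simpleReflection_eq, Equiv.swap_inv]
  simp only [Equiv.Perm.mul_apply, perm_inv_apply_self]
  simp only [Equiv.swap_apply_def, leftPos, rightPos, Fin.ext_iff, Fin.lt_def] at *
  split_ifs <;> simp only <;> omega

theorem inv_lt_inv_iff_of_notMem_crossings {σ : Equiv.Perm (Fin n)} {w : List (Fin (n - 1))}
    {a b : Fin n} (h1 : (a.1, b.1) ∉ crossings σ w) (h2 : (b.1, a.1) ∉ crossings σ w) :
    (σ * wordProd w)⁻¹ a < (σ * wordProd w)⁻¹ b ↔ σ⁻¹ a < σ⁻¹ b := by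
  induction w generalizing σ with
  | nil => rw [wordProd_nil, mul_one]
  | cons i w ih =>
    simp only [crossings, List.mem_cons, not_or] at h1 h2
    rw [wordProd_cons, ← mul_assoc, ih h1.2 h2.2]
    refine inv_mul_simpleReflection_lt_iff σ i ?_ ?_
    · intro e
      simp only [Prod.mk.injEq] at e
      exact h1.1 (by rw [e.1, e.2])
    · intro e
      simp only [Prod.mk.injEq] at e
      exact h2.1 (by rw [e.1, e.2])

/-- In every crossing the smaller value is on the left. -/
def Ascending (l : List (ℕ × ℕ)) : Prop := ∀ p ∈ l, p.1 < p.2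

/-- Once the larger value stands to the left, undoing this would need a crossing with the larger
value on the left, which an ascending sequence excludes. -/
theorem notMem_crossings_of_inv_lt {σ : Equiv.Perm (Fin n)} {w : List (Fin (n - 1))}
    (hw : Ascending (crossings σ w)) {a b : Fin n} (hab : a < b) (h : σ⁻¹ b < σ⁻¹ a) :
    (a.1, b.1) ∉ crossings σ w := by
  induction w generalizing σ with
  | nil => simp [crossings]
  | cons i w ih =>
    have hw1 := hw _ (List.mem_cons_self ..)
    have n1 : (a, b) ≠ (σ (leftPos i), σ (rightPos i)) := by
      intro e
      simp only [Prod.mk.injEq] at e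
      rw [e.1, e.2, perm_inv_apply_self, perm_inv_apply_self] at h
      simp [leftPos, rightPos, Fin.lt_def] at h
    have n2 : (b, a) ≠ (σ (leftPos i), σ (rightPos i)) := by
      intro e
      simp only [Prod.mk.injEq] at e
      simp only [← e.1, ← e.2] at hw1
      exact lt_asymm hab hw1
    simp only [crossings, List.mem_cons, not_or]
    constructor
    · intro e
      simp only [Prod.mk.injEq] at e
      exact n1 (Prod.ext (Fin.ext e.1) (Fin.ext e.2))
    · refine ih (fun p hp => hw p (List.mem_cons_of_mem _ hp)) ?_
      rwa [inv_mul_simpleReflection_lt_iff σ i n2 n1]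

theorem nodup_crossings_of_ascending {σ : Equiv.Perm (Fin n)} {w : List (Fin (n - 1))}
    (hw : Ascending (crossings σ w)) : (crossings σ w).Nodup := by
  induction w generalizing σ with
  | nil => simp [crossings]
  | cons i w ih =>
    have hw' : Ascending (crossings (σ * simpleReflection i) w) :=
      fun p hp => hw p (List.mem_cons_of_mem _ hp)
    refine List.nodup_cons.2 ⟨?_, ih hw'⟩
    refine notMem_crossings_of_inv_lt hw' (hw _ (List.mem_cons_self ..)) ?_
    rw [mul_inv_rev, simpleReflection_eq, Equiv.swap_inv]
    simp [leftPos, rightPos, Fin.lt_def]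

theorem lt_of_mem_crossings {σ : Equiv.Perm (Fin n)} {w : List (Fin (n - 1))} {p : ℕ × ℕ}
    (h : p ∈ crossings σ w) : p.1 < n ∧ p.2 < n := by
  induction w generalizing σ with
  | nil => simp [crossings] at h
  | cons i w ih =>
    rcases List.mem_cons.1 h with rfl | h
    · exact ⟨Fin.is_lt _, Fin.is_lt _⟩
    · exact ih h

theorem ne_of_mem_crossings {σ : Equiv.Perm (Fin n)} {w : List (Fin (n - 1))} {p : ℕ × ℕ}
    (h : p ∈ crossings σ w) : p.1 ≠ p.2 := by
  induction w generalizing σ with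
  | nil => simp [crossings] at h
  | cons i w ih =>
    rcases List.mem_cons.1 h with rfl | h
    · intro e
      have := σ.injective (Fin.ext e)
      simp [leftPos, rightPos] at this
    · exact ih h

theorem longest_inv_lt_iff {a b : Fin n} : (longest n)⁻¹ a < (longest n)⁻¹ b ↔ b < a := by
  have : (longest n)⁻¹ = longest n := rfl
  rw [this, longest, Fin.revPerm_apply, Fin.revPerm_apply, Fin.rev_lt_rev]

/-- A pair that never crosses keeps its relative order, whereas the longest permutation inverts
every pair. -/
theorem mem_crossings_of_wordProd_eq_longest {w : List (Fin (n - 1))}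
    (hw : wordProd w = longest n) {p : ℕ × ℕ} (hp : p ∈ pairs n) :
    p ∈ crossings 1 w ∨ p.swap ∈ crossings 1 w := by
  obtain ⟨a, b⟩ := p
  obtain ⟨hab, hb⟩ := mem_pairs.1 hp
  simp only at hab hb
  by_contra! h
  have := inv_lt_inv_iff_of_notMem_crossings (a := ⟨a, by omega⟩) (b := ⟨b, hb⟩) h.1 h.2
  rw [one_mul, hw, longest_inv_lt_iff] at this
  simp only [inv_one, Equiv.Perm.one_apply, Fin.mk_lt_mk] at this
  omega

/-- The pair with its entries in increasing order. -/
def sortPair (p : ℕ × ℕ) : ℕ × ℕ := (min p.1 p.2, max p.1 p.2)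

theorem sortPair_of_lt {p : ℕ × ℕ} (h : p.1 < p.2) : sortPair p = p := by
  simp [sortPair, h.le]

theorem sortPair_swap (p : ℕ × ℕ) : sortPair p.swap = sortPair p := by
  simp [sortPair, min_comm, max_comm]

/-- For a word not known to be reduced, a pair may cross in either direction; sorting the entries
makes the count of pairs possible. -/
theorem toFinset_map_sortPair_crossings {w : List (Fin (n - 1))} (hw : wordProd w = longest n) :
    ((crossings 1 w).map sortPair).toFinset = pairs n := by
  ext p
  rw [List.mem_toFinset, List.mem_map]
  constructor
  · rintro ⟨q, hq, rfl⟩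
    have := lt_of_mem_crossings hq
    have := ne_of_mem_crossings hq
    rw [mem_pairs]
    simp only [sortPair]
    omega
  · intro hp
    have hs := sortPair_of_lt (mem_pairs.1 hp).1
    rcases mem_crossings_of_wordProd_eq_longest hw hp with h | h
    · exact ⟨p, h, hs⟩
    · exact ⟨p.swap, h, by rw [sortPair_swap, hs]⟩

theorem choose_two_le_length {w : List (Fin (n - 1))} (hw : wordProd w = longest n) :
    n.choose 2 ≤ w.length := by
  rw [← card_pairs, ← toFinset_map_sortPair_crossings hw]
  refine (List.toFinset_card_le _).trans ?_
  rw [List.length_map, length_crossings]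

/-- At this length each pair crosses only once. Up to that moment it is in its initial order, so the
smaller value is on the left. -/
theorem ascending_of_length_le {w : List (Fin (n - 1))} (hw : wordProd w = longest n)
    (hl : w.length ≤ n.choose 2) : Ascending (crossings 1 w) := by
  have hnd : ((crossings 1 w).map sortPair).Nodup := by
    rw [← Multiset.coe_nodup, ← Multiset.toFinset_card_eq_card_iff_nodup]
    have h := congrArg Finset.card (toFinset_map_sortPair_crossings hw)
    rw [card_pairs] at h
    have h' := choose_two_le_length hw
    rw [Multiset.coe_card, List.length_map, length_crossings]
    exact h.trans (le_antisymm h' hl)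
  intro p hp
  obtain ⟨x, y, e⟩ := List.append_of_mem hp
  obtain ⟨u, v, rfl, rfl, hv⟩ := exists_of_crossings_eq_append e
  obtain ⟨i, v, rfl, rfl, -⟩ := exists_of_crossings_eq_cons hv
  rw [e, List.map_append, List.map_cons] at hnd
  have hnot : ∀ q ∈ crossings 1 u, sortPair q ≠ _ := fun q hq =>
    (List.nodup_append.1 hnd).2.2 _ (List.mem_map_of_mem hq) _ (List.mem_cons_self ..)
  have key := inv_lt_inv_iff_of_notMem_crossings (σ := 1) (w := u)
    (a := (1 * wordProd u) (leftPos i)) (b := (1 * wordProd u) (rightPos i))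
    (fun h => hnot _ h rfl) (fun h => hnot _ h (sortPair_swap (_, _)))
  rw [perm_inv_apply_self, perm_inv_apply_self] at key
  exact key.1 (by simp [leftPos, rightPos, Fin.lt_def])

theorem length_le_of_ascending {w : List (Fin (n - 1))} (hw : Ascending (crossings 1 w)) :
    w.length ≤ n.choose 2 := by
  rw [← length_crossings 1, ← card_pairs,
    ← List.toFinset_card_of_nodup (nodup_crossings_of_ascending hw)]
  refine Finset.card_le_card fun p hp => ?_
  rw [List.mem_toFinset] at hp
  exact mem_pairs.2 ⟨hw p hp, (lt_of_mem_crossings hp).2⟩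

/-- Composed with the reversal, a decreasing arrangement becomes an order automorphism of `Fin (n +
1)`, and the identity is the only one. -/
theorem eq_longest_of_forall_lt {σ : Equiv.Perm (Fin n)}
    (h : ∀ i : Fin (n - 1), σ (rightPos i) < σ (leftPos i)) : σ = longest n := by
  rcases n with _ | n
  · exact Subsingleton.elim _ _
  have hanti : StrictAnti σ := Fin.strictAnti_iff_succ_lt.2 fun i => h i
  have hmono : StrictMono (σ * longest (n + 1)) := by
    intro a b hab
    exact hanti (Fin.rev_lt_rev.2 hab)
  have : σ * longest (n + 1) = 1 := by
    ext a
    have := congrFun (Subsingleton.elim (α := Fin (n + 1) ≃o Fin (n + 1))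
      (hmono.orderIsoOfSurjective _ (Equiv.surjective _)) (OrderIso.refl _) ▸ rfl :
        (fun a => (hmono.orderIsoOfSurjective _ (Equiv.surjective _)) a) = fun a => a) a
    simpa using congrArg Fin.val this
  rw [mul_eq_one_iff_eq_inv.1 this]
  rfl

/-- Ascending words have bounded length. A longest one leaves no ascent, because the corresponding
letter could be appended; so its arrangement is decreasing. -/
theorem exists_ascending_word (n : ℕ) :
    ∃ w : List (Fin (n - 1)), wordProd w = longest n ∧ Ascending (crossings 1 w) := by
  have ⟨w, hw, hmax⟩ : ∃ w : List (Fin (n - 1)), Ascending (crossings 1 w) ∧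
      ∀ v : List (Fin (n - 1)), Ascending (crossings 1 v) → v.length ≤ w.length := by
    have hne : {w : List (Fin (n - 1)) | Ascending (crossings 1 w)}.Nonempty :=
      ⟨[], by simp [Ascending, crossings]⟩
    have hfin : {w : List (Fin (n - 1)) | Ascending (crossings 1 w)}.Finite :=
      (List.finite_length_le _ (n.choose 2)).subset fun w hw => length_le_of_ascending hw
    obtain ⟨w, hw, h⟩ := Set.exists_max_image _ List.length hfin hne
    exact ⟨w, hw, h⟩
  refine ⟨w, eq_longest_of_forall_lt fun i => ?_, hw⟩
  by_contra h
  have hlt : wordProd w (leftPos i) < wordProd w (rightPos i) := by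
    refine lt_of_le_of_ne (not_lt.1 h) fun e => ?_
    have := (wordProd w).injective e
    simp [leftPos, rightPos] at this
  have := hmax (w ++ [i]) (by
    intro p hp
    rw [crossings_append, List.mem_append] at hp
    rcases hp with hp | hp
    · exact hw p hp
    · simp only [crossings, one_mul, List.mem_singleton] at hp
      rw [hp]
      exact hlt)
  simp at this

theorem isReducedWord_longest_iff {w : List (Fin (n - 1))} :
    IsReducedWord (longest n) w ↔ wordProd w = longest n ∧ w.length = n.choose 2 := by
  constructor
  · rintro ⟨hw, hmin⟩
    obtain ⟨v, hv, ha⟩ := exists_ascending_word n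
    exact ⟨hw, le_antisymm ((hmin v hv).trans (length_le_of_ascending ha))
      (choose_two_le_length hw)⟩
  · rintro ⟨hw, hl⟩
    exact ⟨hw, fun v hv => hl.le.trans (choose_two_le_length hv)⟩

theorem ascending_crossings {w : List (Fin (n - 1))} (hw : IsReducedWord (longest n) w) :
    Ascending (crossings 1 w) := by
  rw [isReducedWord_longest_iff] at hw
  exact ascending_of_length_le hw.1 hw.2.le

/-- The crossings of an ascending word are the inversions of its product. Applied to a prefix, this
tells which pairs have crossed so far from the arrangement reached. -/
theorem mem_crossings_iff_inv_lt {w : List (Fin (n - 1))} (hw : Ascending (crossings 1 w))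
    {a b : Fin n} (hab : a < b) :
    (a.1, b.1) ∈ crossings 1 w ↔ (wordProd w)⁻¹ b < (wordProd w)⁻¹ a := by
  constructor
  · intro h
    obtain ⟨x, y, e⟩ := List.append_of_mem h
    obtain ⟨u, v, rfl, rfl, hv⟩ := exists_of_crossings_eq_append e
    obtain ⟨i, v, rfl, hi, hy⟩ := exists_of_crossings_eq_cons hv
    have hnd := nodup_crossings_of_ascending hw
    rw [e] at hnd
    have hay : (a.1, b.1) ∉ y := by
      have := (List.nodup_append.1 hnd).2.1
      exact (List.nodup_cons.1 this).1
    have hby : (b.1, a.1) ∉ y := by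
      intro h'
      have := hw (b.1, a.1) (by rw [e]; simp [h'])
      exact lt_asymm hab this
    rw [← hy] at hay hby
    have key := inv_lt_inv_iff_of_notMem_crossings hby hay
    rw [one_mul, mul_assoc, ← wordProd_cons, ← wordProd_append] at key
    rw [key]
    simp only [Prod.mk.injEq, one_mul] at hi
    rw [← Fin.ext hi.1, ← Fin.ext hi.2, mul_inv_rev, simpleReflection_eq, Equiv.swap_inv]
    simp [leftPos, rightPos, Fin.lt_def]
  · intro h
    by_contra hn
    have hn' : (b.1, a.1) ∉ crossings 1 w := fun h' => lt_asymm hab (hw _ h')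
    have := (inv_lt_inv_iff_of_notMem_crossings hn' hn).1 (by simpa using h)
    simp only [inv_one, Equiv.Perm.one_apply] at this
    exact lt_asymm hab this

theorem mem_crossings_iff {w : List (Fin (n - 1))} (hw : IsReducedWord (longest n) w)
    (p : ℕ × ℕ) : p ∈ crossings 1 w ↔ p ∈ pairs n := by
  have ha := ascending_crossings hw
  constructor
  · exact fun hp => mem_pairs.2 ⟨ha p hp, (lt_of_mem_crossings hp).2⟩
  · intro hp
    refine (mem_crossings_of_wordProd_eq_longest hw.1 hp).resolve_right fun h => ?_
    exact lt_asymm (ha _ h) (mem_pairs.1 hp).1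

theorem isConvexOrder_crossings {w : List (Fin (n - 1))} (hw : IsReducedWord (longest n) w) :
    IsConvexOrder n (crossings 1 w) where
  nodup := nodup_crossings_of_ascending (ascending_crossings hw)
  mem_iff := mem_crossings_iff hw
  convex a b c hab hbc hc := by
    have ha := ascending_crossings hw
    have hnd := nodup_crossings_of_ascending ha
    have mem : ∀ i j, i < j → j < n → (i, j) ∈ crossings 1 w := fun i j hij hj =>
      (mem_crossings_iff hw _).2 (mem_pairs.2 ⟨hij, hj⟩)
    -- Cut the word at the crossing of `a` and `c`. These are then adjacent, and `b` is left of both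
    -- exactly when `(a, b)` has crossed already, and right of both exactly when `(b, c)` has.
    obtain ⟨x, y, e⟩ := List.append_of_mem (mem a c (by omega) hc)
    have mab := mem a b hab (by omega)
    have mbc := mem b c hbc hc
    obtain ⟨u, v, rfl, rfl, hv⟩ := exists_of_crossings_eq_append e
    obtain ⟨i, v, rfl, hi, -⟩ := exists_of_crossings_eq_cons hv
    have hu : Ascending (crossings 1 u) := fun p hp => ha p (by rw [e]; simp [hp])
    simp only [Prod.mk.injEq, one_mul] at hi
    have ea : (⟨a, by omega⟩ : Fin n) = wordProd u (leftPos i) := Fin.ext hi.1.symm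
    have ec : (⟨c, by omega⟩ : Fin n) = wordProd u (rightPos i) := Fin.ext hi.2.symm
    have h1 : (a, b) ∈ crossings 1 u ↔ (wordProd u)⁻¹ ⟨b, by omega⟩ < leftPos i :=
      (mem_crossings_iff_inv_lt hu (a := ⟨a, by omega⟩) (b := ⟨b, by omega⟩) hab).trans
        (by rw [ea, perm_inv_apply_self])
    have h2 : (b, c) ∈ crossings 1 u ↔ rightPos i < (wordProd u)⁻¹ ⟨b, by omega⟩ :=
      (mem_crossings_iff_inv_lt hu (a := ⟨b, by omega⟩) (b := ⟨c, by omega⟩) hbc).trans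
        (by rw [ec, perm_inv_apply_self])
    have n1 : (wordProd u)⁻¹ ⟨b, by omega⟩ ≠ leftPos i := by
      rw [Ne, Equiv.Perm.inv_eq_iff_eq, ← ea]
      simp; omega
    have n2 : (wordProd u)⁻¹ ⟨b, by omega⟩ ≠ rightPos i := by
      rw [Ne, Equiv.Perm.inv_eq_iff_eq, ← ec]
      simp; omega
    rw [e] at hnd mab mbc ⊢
    have d1 : (a, b) ≠ (a, c) := by simp; omega
    have d2 : (b, c) ≠ (a, c) := by simp; omega
    simp only [Fin.lt_def, leftPos, rightPos, Ne, Fin.ext_iff] at h1 h2 n1 n2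
    have right : ∀ q ∈ crossings 1 u ++ (a, c) :: y, q ≠ (a, c) → q ∉ crossings 1 u → q ∈ y := by
      intro q hq hne hn
      simpa [hne, hn] using hq
    by_cases hb : (a, b) ∈ crossings 1 u
    · exact Or.inl ⟨before_append_left hnd hb,
        before_append_right hnd (right _ mbc d2 fun h => by
          have := h1.1 hb
          have := h2.1 h
          omega)⟩
    · refine Or.inr ⟨before_append_left hnd (h2.2 ?_),
        before_append_right hnd (right _ mab d1 hb)⟩
      have := h1.not.1 hb
      omega

end Words

/-! ### Correspondence between moves of words and moves of crossing sequences. -/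

section Moves

variable {n : ℕ}

theorem simpleReflection_leftPos (i : Fin (n - 1)) :
    simpleReflection i (leftPos i) = rightPos i :=
  Equiv.swap_apply_left _ _

theorem simpleReflection_rightPos (i : Fin (n - 1)) :
    simpleReflection i (rightPos i) = leftPos i :=
  Equiv.swap_apply_right _ _

theorem simpleReflection_of_ne {i : Fin (n - 1)} {a : Fin n} (h1 : a.1 ≠ i.1)
    (h2 : a.1 ≠ i.1 + 1) : simpleReflection i a = a :=
  Equiv.swap_apply_of_ne_of_ne (fun e => h1 (congrArg Fin.val e)) (fun e => h2 (congrArg Fin.val e))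

theorem simpleReflection_comm {j k : Fin (n - 1)} (h : j.1 + 1 < k.1 ∨ k.1 + 1 < j.1) :
    simpleReflection j * simpleReflection k = simpleReflection k * simpleReflection j := by
  refine (Equiv.Perm.Disjoint.commute ?_).eq
  intro a
  by_cases h1 : a.1 = j.1 ∨ a.1 = j.1 + 1
  · exact Or.inr (simpleReflection_of_ne (by omega) (by omega))
  · exact Or.inl (simpleReflection_of_ne (by omega) (by omega))

theorem leftPos_eq_rightPos {j k : Fin (n - 1)} (h : k.1 = j.1 + 1) : leftPos k = rightPos j :=
  Fin.ext h

theorem simpleReflection_braid {j k : Fin (n - 1)} (h : k.1 = j.1 + 1) :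
    simpleReflection j * simpleReflection k * simpleReflection j =
      simpleReflection k * simpleReflection j * simpleReflection k := by
  have e := leftPos_eq_rightPos h
  have h1 : leftPos j ≠ rightPos j := by simp [leftPos, rightPos]
  have h2 : leftPos j ≠ rightPos k := by simp [leftPos, rightPos, h]; omega
  have h3 : rightPos j ≠ rightPos k := by simp [rightPos, h]
  simp only [simpleReflection_eq, e]
  rw [Equiv.swap_mul_swap_mul_swap h1 h2, Equiv.swap_comm (leftPos j) (rightPos j),
    Equiv.swap_comm (rightPos j) (rightPos k), Equiv.swap_mul_swap_mul_swap h3.symm h2.symm,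
    Equiv.swap_comm]

theorem crossings_comm (σ : Equiv.Perm (Fin n)) {j k : Fin (n - 1)}
    (h : j.1 + 1 < k.1 ∨ k.1 + 1 < j.1) (w : List (Fin (n - 1))) :
    crossings σ (j :: k :: w) = ((σ (leftPos j)).1, (σ (rightPos j)).1) ::
      ((σ (leftPos k)).1, (σ (rightPos k)).1) ::
        crossings (σ * (simpleReflection j * simpleReflection k)) w := by
  simp only [crossings, Equiv.Perm.mul_apply, mul_assoc]
  rw [simpleReflection_of_ne (a := leftPos k) (by simp only [leftPos]; omega)
    (by simp only [leftPos]; omega), simpleReflection_of_ne (a := rightPos k)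
    (by simp only [rightPos]; omega) (by simp only [rightPos]; omega)]

theorem crossings_braid_up (σ : Equiv.Perm (Fin n)) {j k : Fin (n - 1)} (h : k.1 = j.1 + 1)
    (w : List (Fin (n - 1))) :
    crossings σ (j :: k :: j :: w) = ((σ (leftPos j)).1, (σ (rightPos j)).1) ::
      ((σ (leftPos j)).1, (σ (rightPos k)).1) :: ((σ (rightPos j)).1, (σ (rightPos k)).1) ::
        crossings (σ * (simpleReflection j * simpleReflection k * simpleReflection j)) w := by
  have e := leftPos_eq_rightPos h
  have h1 : simpleReflection j (rightPos k) = rightPos k :=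
    simpleReflection_of_ne (by simp only [rightPos]; omega) (by simp only [rightPos]; omega)
  have h2 : simpleReflection k (leftPos j) = leftPos j :=
    simpleReflection_of_ne (by simp only [leftPos]; omega) (by simp only [leftPos]; omega)
  have h3 : simpleReflection k (rightPos j) = rightPos k := by
    rw [← e, simpleReflection_leftPos]
  simp only [crossings, Equiv.Perm.mul_apply, mul_assoc, e, h1, h2, h3, simpleReflection_leftPos,
    simpleReflection_rightPos]

theorem crossings_braid_down (σ : Equiv.Perm (Fin n)) {j k : Fin (n - 1)} (h : k.1 = j.1 + 1)
    (w : List (Fin (n - 1))) :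
    crossings σ (k :: j :: k :: w) = ((σ (rightPos j)).1, (σ (rightPos k)).1) ::
      ((σ (leftPos j)).1, (σ (rightPos k)).1) :: ((σ (leftPos j)).1, (σ (rightPos j)).1) ::
        crossings (σ * (simpleReflection j * simpleReflection k * simpleReflection j)) w := by
  have e := leftPos_eq_rightPos h
  rw [simpleReflection_braid h]
  have h1 : simpleReflection j (rightPos k) = rightPos k :=
    simpleReflection_of_ne (by simp only [rightPos]; omega) (by simp only [rightPos]; omega)
  have h2 : simpleReflection k (leftPos j) = leftPos j :=
    simpleReflection_of_ne (by simp only [leftPos]; omega) (by simp only [leftPos]; omega)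
  have h3 : simpleReflection k (rightPos j) = rightPos k := by
    rw [← e, simpleReflection_leftPos]
  have h4 : simpleReflection k (rightPos k) = rightPos j := by
    rw [simpleReflection_rightPos, e]
  simp only [crossings, Equiv.Perm.mul_apply, mul_assoc, e, h1, h2, h3, h4,
    simpleReflection_rightPos]

theorem CommMove.pairCommMove {u v : List (Fin (n - 1))} (h : CommMove u v) :
    PairCommMove (crossings 1 u) (crossings 1 v) := by
  obtain ⟨x, y, j, k, hjk, rfl, rfl⟩ := h
  simp only [List.append_assoc, List.cons_append, List.nil_append]
  rw [crossings_append, crossings_append, crossings_comm _ hjk, crossings_comm _ hjk.symm,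
    simpleReflection_comm hjk]
  refine ⟨_, _, _, _, ?_, ?_, ?_, ?_, rfl, rfl⟩ <;>
  · intro e
    have := congrArg Fin.val ((1 * wordProd x).injective (Fin.ext e))
    simp only [leftPos, rightPos] at this
    omega

theorem pairBraidMove_of_up {x y : List (Fin (n - 1))} {j k : Fin (n - 1)} (hjk : k.1 = j.1 + 1)
    (ha : Ascending (crossings 1 (x ++ j :: k :: j :: y))) :
    PairBraidMove (crossings 1 (x ++ j :: k :: j :: y)) (crossings 1 (x ++ k :: j :: k :: y)) := by
  rw [crossings_append, crossings_braid_up _ hjk] at ha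
  rw [crossings_append, crossings_append, crossings_braid_up _ hjk, crossings_braid_down _ hjk]
  exact ⟨_, _, _, _, _, ha (_, _) (by simp), ha (_, _) (by simp), Or.inl ⟨rfl, rfl⟩⟩

theorem BraidMove.pairBraidMove {u v : List (Fin (n - 1))} (h : BraidMove u v)
    (hu : Ascending (crossings 1 u)) (hv : Ascending (crossings 1 v)) :
    PairBraidMove (crossings 1 u) (crossings 1 v) := by
  obtain ⟨x, y, j, k, hjk | hjk, rfl, rfl⟩ := h
  · simp only [List.append_assoc, List.cons_append, List.nil_append] at *
    exact pairBraidMove_of_up hjk hu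
  · simp only [List.append_assoc, List.cons_append, List.nil_append] at *
    exact (pairBraidMove_of_up hjk hv).symm

theorem CommMove.isReducedWord {u v : List (Fin (n - 1))} (h : CommMove u v)
    (hu : IsReducedWord (longest n) u) : IsReducedWord (longest n) v := by
  rw [isReducedWord_longest_iff] at hu ⊢
  obtain ⟨x, y, j, k, hjk, rfl, rfl⟩ := h
  refine ⟨?_, by rw [← hu.2]; simp⟩
  rw [← hu.1]
  simp only [wordProd_append, wordProd_cons, wordProd_nil, mul_one, simpleReflection_comm hjk]

theorem BraidMove.isReducedWord {u v : List (Fin (n - 1))} (h : BraidMove u v)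
    (hu : IsReducedWord (longest n) u) : IsReducedWord (longest n) v := by
  rw [isReducedWord_longest_iff] at hu ⊢
  obtain ⟨x, y, j, k, hjk, rfl, rfl⟩ := h
  refine ⟨?_, by rw [← hu.2]; simp⟩
  rw [← hu.1]
  have : simpleReflection k * (simpleReflection j * simpleReflection k) =
      simpleReflection j * (simpleReflection k * simpleReflection j) := by
    rw [← mul_assoc, ← mul_assoc]
    rcases hjk with hjk | hjk
    · exact (simpleReflection_braid hjk).symm
    · exact simpleReflection_braid hjk
  simp only [wordProd_append, wordProd_cons, wordProd_nil, mul_one, this]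

/-- Equal or neighbouring letters in succession exchange pairs with a common value, so disjoint
pairs come from commuting letters. -/
theorem exists_commMove {w : List (Fin (n - 1))} {l : List (ℕ × ℕ)}
    (h : PairCommMove (crossings 1 w) l) : ∃ w', CommMove w w' ∧ crossings 1 w' = l := by
  obtain ⟨x, y, p, q, h1, h2, h3, h4, e, rfl⟩ := h
  obtain ⟨u, v, rfl, rfl, hv⟩ := exists_of_crossings_eq_append e
  obtain ⟨j, v, rfl, rfl, hv'⟩ := exists_of_crossings_eq_cons hv
  obtain ⟨k, v, rfl, rfl, rfl⟩ := exists_of_crossings_eq_cons hv'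
  have hjk : j.1 + 1 < k.1 ∨ k.1 + 1 < j.1 := by
    by_contra hn
    have : j.1 = k.1 ∨ k.1 = j.1 + 1 ∨ j.1 = k.1 + 1 := by omega
    simp only [Equiv.Perm.mul_apply] at h2 h3 h4 h1
    rcases this with hjk | hjk | hjk
    · obtain rfl := Fin.ext hjk
      rw [simpleReflection_leftPos] at h3
      exact h3 rfl
    · rw [leftPos_eq_rightPos hjk, simpleReflection_rightPos] at h1
      exact h1 rfl
    · rw [← leftPos_eq_rightPos hjk, simpleReflection_leftPos] at h4
      exact h4 rfl
  refine ⟨u ++ [k, j] ++ v, ⟨u, v, j, k, hjk, by simp, rfl⟩, ?_⟩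
  have e2 := crossings_comm (1 * wordProd u) hjk v
  simp only [crossings, List.cons.injEq, true_and] at e2
  rw [e2.1, e2.2, List.append_assoc, crossings_append, List.cons_append, List.cons_append,
    List.nil_append, crossings_comm _ hjk.symm, simpleReflection_comm hjk]

/-- Following one value through the crossings determines the letters: in the order `(a, b)`, `(a,
c)`, `(b, c)` the value `a` moves right twice, so the second letter is one larger than the first,
and the position of `b` makes the third equal to the first. The opposite order is analogous, with
`c` moving left. -/
theorem exists_braidMove {w : List (Fin (n - 1))} {l : List (ℕ × ℕ)}
    (h : PairBraidMove (crossings 1 w) l) : ∃ w', BraidMove w w' ∧ crossings 1 w' = l := by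
  obtain ⟨x, y, a, b, c, hab, hbc, ⟨e, rfl⟩ | ⟨rfl, e⟩⟩ := h
  · obtain ⟨u, v, rfl, rfl, hv⟩ := exists_of_crossings_eq_append e
    obtain ⟨j, v, rfl, h1, hv⟩ := exists_of_crossings_eq_cons hv
    obtain ⟨k, v, rfl, h2, hv⟩ := exists_of_crossings_eq_cons hv
    obtain ⟨i, v, rfl, h3, rfl⟩ := exists_of_crossings_eq_cons hv
    simp only [Prod.mk.injEq, Equiv.Perm.mul_apply (1 * wordProd u),
      Equiv.Perm.mul_apply (1 * wordProd u * simpleReflection j)] at h1 h2 h3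
    have hk : k.1 = j.1 + 1 := by
      have := (1 * wordProd u).injective (Fin.ext (h2.1.trans h1.1.symm))
      rw [← simpleReflection_rightPos j] at this
      exact congrArg Fin.val ((simpleReflection j).injective this)
    obtain rfl : i = j := by
      have := (1 * wordProd u).injective (Fin.ext (h3.1.trans h1.2.symm))
      rw [← simpleReflection_leftPos j] at this
      have := (simpleReflection j).injective this
      rw [← simpleReflection_of_ne (i := k) (a := leftPos j) (by simp only [leftPos]; omega)
        (by simp only [leftPos]; omega)] at this
      exact Fin.ext (Fin.mk.inj ((simpleReflection k).injective this))
    refine ⟨u ++ [k, i, k] ++ v, ⟨u, v, i, k, Or.inl hk, by simp, rfl⟩, ?_⟩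
    have e2 := crossings_braid_up (1 * wordProd u) hk v
    simp only [crossings, List.cons.injEq] at e2
    rw [e2.2.2.2, List.append_assoc, crossings_append, List.cons_append, List.cons_append,
      List.cons_append, List.nil_append, crossings_braid_down _ hk]
    have h4 := h2.2
    rw [simpleReflection_of_ne (by simp only [rightPos]; omega)
      (by simp only [rightPos]; omega)] at h4
    rw [h1.1, h1.2, h4]
  · obtain ⟨u, v, rfl, rfl, hv⟩ := exists_of_crossings_eq_append e
    obtain ⟨j, v, rfl, h1, hv⟩ := exists_of_crossings_eq_cons hv
    obtain ⟨k, v, rfl, h2, hv⟩ := exists_of_crossings_eq_cons hv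
    obtain ⟨i, v, rfl, h3, rfl⟩ := exists_of_crossings_eq_cons hv
    simp only [Prod.mk.injEq, Equiv.Perm.mul_apply (1 * wordProd u),
      Equiv.Perm.mul_apply (1 * wordProd u * simpleReflection j)] at h1 h2 h3
    have hk : j.1 = k.1 + 1 := by
      have := (1 * wordProd u).injective (Fin.ext (h2.2.trans h1.2.symm))
      rw [← simpleReflection_leftPos j] at this
      exact (congrArg Fin.val ((simpleReflection j).injective this)).symm
    obtain rfl : i = j := by
      have := (1 * wordProd u).injective (Fin.ext (h3.1.trans h2.1.symm))
      have := (simpleReflection j).injective this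
      rw [← simpleReflection_rightPos k] at this
      have := congrArg Fin.val ((simpleReflection k).injective this)
      exact Fin.ext (this.trans hk.symm)
    refine ⟨u ++ [k, i, k] ++ v, ⟨u, v, i, k, Or.inr hk, by simp, rfl⟩, ?_⟩
    have e2 := crossings_braid_down (1 * wordProd u) hk v
    simp only [crossings, List.cons.injEq] at e2
    rw [e2.2.2.2, List.append_assoc, crossings_append, List.cons_append, List.cons_append,
      List.cons_append, List.nil_append, crossings_braid_up _ hk]
    have h4 := h2.1
    rw [simpleReflection_of_ne (by simp only [leftPos]; omega)
      (by simp only [leftPos]; omega)] at h4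
    have h5 := h1.1
    rw [leftPos_eq_rightPos hk] at h5
    rw [h1.2, h5, h4]

end Moves

/-! ### Diameters from a rank function with unique extremes. -/

section Graphs

/-- Either `φ u + φ v` or `(N - φ u) + (N - φ v)` is at most `N`, so one of the routes through `r₀`
and `r₁` is short enough. Since `φ` rises by at most one along an edge, `r₀` and `r₁` are at
distance at least `N`. -/
theorem connected_and_diam_eq_of_potential {V : Type*} {G : SimpleGraph V} {φ : V → ℕ} {N : ℕ}
    {r₀ r₁ : V} (hle : ∀ u, φ u ≤ N) (h₀ : φ r₀ = 0) (h₁ : φ r₁ = N)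
    (lip : ∀ u v, G.Adj u v → φ v ≤ φ u + 1) (d₀ : ∀ u, G.edist u r₀ ≤ φ u)
    (d₁ : ∀ u, G.edist u r₁ ≤ (N - φ u : ℕ)) : G.Connected ∧ G.diam = N := by
  have upper : G.ediam ≤ N := by
    refine SimpleGraph.ediam_le_of_edist_le fun u v => ?_
    rcases le_total (φ u + φ v) N with h | h
    · calc G.edist u v ≤ G.edist u r₀ + G.edist r₀ v := SimpleGraph.edist_triangle
        _ ≤ φ u + φ v := add_le_add (d₀ u) (SimpleGraph.edist_comm.trans_le (d₀ v))
        _ ≤ N := by exact_mod_cast h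
    · calc G.edist u v ≤ G.edist u r₁ + G.edist r₁ v := SimpleGraph.edist_triangle
        _ ≤ (N - φ u : ℕ) + (N - φ v : ℕ) :=
          add_le_add (d₁ u) (SimpleGraph.edist_comm.trans_le (d₁ v))
        _ ≤ N := by
          have := hle u
          have := hle v
          norm_cast
          omega
  have walk : ∀ u v (p : G.Walk u v), φ v ≤ φ u + p.length := by
    intro u v p
    induction p with
    | nil => simp
    | cons h p ih =>
      have := lip _ _ h
      rw [SimpleGraph.Walk.length_cons]
      omega
  have htop : G.ediam ≠ ⊤ := ne_top_of_le_ne_top (ENat.natCast_ne_top N) upper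
  have : Nonempty V := ⟨r₀⟩
  have hconn := SimpleGraph.connected_of_ediam_ne_top htop
  refine ⟨hconn, le_antisymm ?_ ?_⟩
  · exact ENat.toNat_le_of_le_natCast upper
  · obtain ⟨p, hp⟩ := hconn.exists_walk_length_eq_dist r₀ r₁
    have := walk _ _ p
    have := SimpleGraph.dist_le_diam htop (u := r₀) (v := r₁)
    omega

variable {V W : Type*} {H₁ H₂ : SimpleGraph V} {G : SimpleGraph W} {π : V → W} {a b : ℕ}

/-- The weights `a` and `b` are the costs in `G` of the two kinds of edges. Costs `1, 1` serve the
full graph and `0, 1` the contraction along `H₁`. -/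
theorem edist_le_of_descent {d t : V → ℕ} {r : V}
    (desc : ∀ u, u ≠ r → ∃ v, (H₁.Adj u v ∧ d v < d u ∧ t v = t u) ∨
      (H₂.Adj u v ∧ t v < t u ∧ d v = d u))
    (c₁ : ∀ u v, H₁.Adj u v → G.edist (π u) (π v) ≤ a)
    (c₂ : ∀ u v, H₂.Adj u v → G.edist (π u) (π v) ≤ b) (u : V) :
    G.edist (π u) (π r) ≤ (a * d u + b * t u : ℕ) := by
  induction hk : d u + t u using Nat.strong_induction_on generalizing u with
  | _ k ih =>
    by_cases hu : u = r
    · rw [hu, SimpleGraph.edist_self]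
      exact zero_le
    · obtain ⟨v, ⟨h, hd, ht⟩ | ⟨h, ht, hd⟩⟩ := desc u hu
      · calc G.edist (π u) (π r) ≤ G.edist (π u) (π v) + G.edist (π v) (π r) :=
              SimpleGraph.edist_triangle
          _ ≤ a + (a * d v + b * t v : ℕ) := add_le_add (c₁ u v h) (ih _ (by omega) v rfl)
          _ ≤ (a * d u + b * t u : ℕ) := by
            rw [ht]
            norm_cast
            nlinarith
      · calc G.edist (π u) (π r) ≤ G.edist (π u) (π v) + G.edist (π v) (π r) :=
              SimpleGraph.edist_triangle
          _ ≤ b + (a * d v + b * t v : ℕ) := add_le_add (c₂ u v h) (ih _ (by omega) v rfl)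
          _ ≤ (a * d u + b * t u : ℕ) := by
            rw [hd]
            norm_cast
            nlinarith

/-- Two statistics on the vertices, bounded by `D` and `T`, such that from every vertex other than
`r₀` one can lower one of them along an edge, keeping the other one, and from every vertex other
than `r₁` one can raise one of them. -/
structure IsBigrading (H₁ H₂ : SimpleGraph V) (d t : V → ℕ) (D T : ℕ) (r₀ r₁ : V) : Prop where
  le₁ : ∀ u, d u ≤ D
  le₂ : ∀ u, t u ≤ T
  min₁ : d r₀ = 0
  min₂ : t r₀ = 0
  max₁ : d r₁ = D
  max₂ : t r₁ = T
  adj₁ : ∀ u v, H₁.Adj u v → t v = t u ∧ d v ≤ d u + 1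
  adj₂ : ∀ u v, H₂.Adj u v → d v = d u ∧ t v ≤ t u + 1
  lower : ∀ u, u ≠ r₀ → ∃ v, (H₁.Adj u v ∧ d v < d u) ∨ (H₂.Adj u v ∧ t v < t u)
  raise : ∀ u, u ≠ r₁ → ∃ v, (H₁.Adj u v ∧ d u < d v) ∨ (H₂.Adj u v ∧ t u < t v)

namespace IsBigrading

variable {d t : V → ℕ} {D T : ℕ} {r₀ r₁ : V}

theorem connected_and_diam_eq (h : IsBigrading H₁ H₂ d t D T r₀ r₁)
    (hπ : Function.Surjective π) {φ : W → ℕ} (hφ : ∀ u, φ (π u) = a * d u + b * t u)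
    (lip : ∀ x y, G.Adj x y → φ y ≤ φ x + 1)
    (c₁ : ∀ u v, H₁.Adj u v → G.edist (π u) (π v) ≤ a)
    (c₂ : ∀ u v, H₂.Adj u v → G.edist (π u) (π v) ≤ b) :
    G.Connected ∧ G.diam = a * D + b * T := by
  refine connected_and_diam_eq_of_potential (φ := φ) (r₀ := π r₀) (r₁ := π r₁) ?_ ?_ ?_ lip ?_ ?_
  · refine hπ.forall.2 fun u => ?_
    rw [hφ]
    exact add_le_add (Nat.mul_le_mul_left a (h.le₁ u)) (Nat.mul_le_mul_left b (h.le₂ u))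
  · rw [hφ, h.min₁, h.min₂, mul_zero, mul_zero, add_zero]
  · rw [hφ, h.max₁, h.max₂]
  · refine hπ.forall.2 fun u => ?_
    rw [hφ]
    refine edist_le_of_descent (fun u hu => ?_) c₁ c₂ u
    obtain ⟨v, ⟨e, hv⟩ | ⟨e, hv⟩⟩ := h.lower u hu
    · exact ⟨v, Or.inl ⟨e, hv, (h.adj₁ u v e).1⟩⟩
    · exact ⟨v, Or.inr ⟨e, hv, (h.adj₂ u v e).1⟩⟩
  · refine hπ.forall.2 fun u => ?_
    have key : a * D + b * T - φ (π u) = a * (D - d u) + b * (T - t u) := by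
      rw [hφ, Nat.mul_sub, Nat.mul_sub]
      have := Nat.mul_le_mul_left a (h.le₁ u)
      have := Nat.mul_le_mul_left b (h.le₂ u)
      omega
    rw [key]
    -- Raising is descent for the complementary statistics `D - d` and `T - t`.
    refine edist_le_of_descent (d := fun u => D - d u) (t := fun u => T - t u)
      (fun u hu => ?_) c₁ c₂ u
    obtain ⟨v, ⟨e, hv⟩ | ⟨e, hv⟩⟩ := h.raise u hu
    · have := h.le₁ v
      exact ⟨v, Or.inl ⟨e, by omega, by rw [(h.adj₁ u v e).1]⟩⟩
    · have := h.le₂ v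
      exact ⟨v, Or.inr ⟨e, by omega, by rw [(h.adj₂ u v e).1]⟩⟩

theorem swap (h : IsBigrading H₁ H₂ d t D T r₀ r₁) : IsBigrading H₂ H₁ t d T D r₀ r₁ where
  le₁ := h.le₂
  le₂ := h.le₁
  min₁ := h.min₂
  min₂ := h.min₁
  max₁ := h.max₂
  max₂ := h.max₁
  adj₁ := h.adj₂
  adj₂ := h.adj₁
  lower u hu := (h.lower u hu).imp fun _ => Or.symm
  raise u hu := (h.raise u hu).imp fun _ => Or.symm

theorem sup (h : IsBigrading H₁ H₂ d t D T r₀ r₁) :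
    (H₁ ⊔ H₂).Connected ∧ (H₁ ⊔ H₂).diam = D + T := by
  have := h.connected_and_diam_eq (G := H₁ ⊔ H₂) (π := id) (a := 1) (b := 1)
    (φ := fun u => d u + t u) Function.surjective_id (fun u => by simp)
    (by
      rintro u v (e | e)
      · have := h.adj₁ u v e
        omega
      · have := h.adj₂ u v e
        omega)
    (fun u v e => (SimpleGraph.edist_eq_one_iff_adj.2 (Or.inl e)).le)
    (fun u v e => (SimpleGraph.edist_eq_one_iff_adj.2 (Or.inr e)).le)
  simpa using this

theorem contractAlong (h : IsBigrading H₁ H₂ d t D T r₀ r₁) :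
    (contractAlong (H₁ ⊔ H₂) H₁).Connected ∧ (contractAlong (H₁ ⊔ H₂) H₁).diam = T := by
  -- `t` does not change along `H₁`, so it descends to the components and serves as the rank of the
  -- contracted graph.
  have const : ∀ u v (p : H₁.Walk u v), p.IsPath → t u = t v := by
    intro u v p _
    induction p with
    | nil => rfl
    | cons e p ih =>
      rename_i hp
      rw [← ih hp.of_cons, (h.adj₁ _ _ e).1]
  have := h.connected_and_diam_eq (G := ReducedWords.contractAlong (H₁ ⊔ H₂) H₁)
    (π := H₁.connectedComponentMk) (a := 0) (b := 1)
    (φ := SimpleGraph.ConnectedComponent.lift t const) Quot.mk_surjective (fun u => by simp)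
    (by
      rintro _ _ ⟨-, u, v, rfl, rfl, e | e⟩
      · have := h.adj₁ u v e
        simp only [SimpleGraph.ConnectedComponent.lift_mk]
        omega
      · have := h.adj₂ u v e
        simp only [SimpleGraph.ConnectedComponent.lift_mk]
        omega)
    (fun u v e => by
      rw [SimpleGraph.ConnectedComponent.eq.2 e.reachable, SimpleGraph.edist_self]
      exact zero_le)
    (fun u v e => by
      by_cases huv : H₁.connectedComponentMk u = H₁.connectedComponentMk v
      · rw [huv, SimpleGraph.edist_self]
        exact zero_le
      · have hadj : (ReducedWords.contractAlong (H₁ ⊔ H₂) H₁).Adj (H₁.connectedComponentMk u)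
            (H₁.connectedComponentMk v) := ⟨huv, u, v, rfl, rfl, Or.inr e⟩
        exact (SimpleGraph.edist_eq_one_iff_adj.2 hadj).le)
  simpa using this

end IsBigrading

end Graphs

/-! ### The bigrading on the reduced words of the longest permutation. -/

section Longest

variable {n : ℕ}

/-- The number of pairs of disjoint pairs of values that cross in decreasing order. -/
def commRank (w : R (longest n)) : ℕ := reversals (quadruples n) (crossings 1 w.1)

/-- The number of triples of values that cross in decreasing order. -/
def braidRank (w : R (longest n)) : ℕ := reversals (triples n) (crossings 1 w.1)

theorem commGraph_adj_ranks {u v : R (longest n)} (h : (commGraph (longest n)).Adj u v) :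
    braidRank v = braidRank u ∧ commRank v ≤ commRank u + 1 :=
  have hm := CommMove.pairCommMove h
  have hn := (isConvexOrder_crossings u.2).nodup
  ⟨hm.reversals_triples hn, hm.reversals_quadruples hn⟩

theorem braidGraph_adj_ranks {u v : R (longest n)} (h : (braidGraph (longest n)).Adj u v) :
    commRank v = commRank u ∧ braidRank v ≤ braidRank u + 1 :=
  have hm := BraidMove.pairBraidMove h (ascending_crossings u.2) (ascending_crossings v.2)
  have hc := isConvexOrder_crossings u.2
  ⟨hm.reversals_quadruples hc.nodup, hm.reversals_triples hc⟩

theorem exists_adj_of_pairMove {u : R (longest n)} {l : List (ℕ × ℕ)} :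
    (PairCommMove (crossings 1 u.1) l →
      ∃ v : R (longest n), (commGraph (longest n)).Adj u v ∧ crossings 1 v.1 = l) ∧
    (PairBraidMove (crossings 1 u.1) l →
      ∃ v : R (longest n), (braidGraph (longest n)).Adj u v ∧ crossings 1 v.1 = l) := by
  constructor
  · intro h
    obtain ⟨w, hw, e⟩ := exists_commMove h
    exact ⟨⟨w, hw.isReducedWord u.2⟩, hw, e⟩
  · intro h
    obtain ⟨w, hw, e⟩ := exists_braidMove h
    exact ⟨⟨w, hw.isReducedWord u.2⟩, hw, e⟩

theorem exists_adj_lower (u : R (longest n)) (hu : ¬ (braidRank u = 0 ∧ commRank u = 0)) :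
    ∃ v, ((commGraph (longest n)).Adj u v ∧ commRank v < commRank u) ∨
      ((braidGraph (longest n)).Adj u v ∧ braidRank v < braidRank u) := by
  obtain ⟨l, ⟨h, hl⟩ | ⟨h, hl⟩⟩ := (isConvexOrder_crossings u.2).exists_lowering_move hu
  · obtain ⟨v, hv, rfl⟩ := exists_adj_of_pairMove.1 h
    exact ⟨v, Or.inl ⟨hv, hl⟩⟩
  · obtain ⟨v, hv, rfl⟩ := exists_adj_of_pairMove.2 h
    exact ⟨v, Or.inr ⟨hv, hl⟩⟩

/-- A lowering move of the reversed crossing sequence, reversed back, is a move of the original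
sequence that raises the complementary count. -/
theorem exists_adj_raise (u : R (longest n))
    (hu : ¬ (braidRank u = (triples n).card ∧ commRank u = (quadruples n).card)) :
    ∃ v, ((commGraph (longest n)).Adj u v ∧ commRank u < commRank v) ∨
      ((braidGraph (longest n)).Adj u v ∧ braidRank u < braidRank v) := by
  have hc := isConvexOrder_crossings u.2
  have h3 := hc.reversals_triples_reverse
  have h4 := hc.reversals_quadruples_reverse
  unfold braidRank commRank at *
  obtain ⟨l, ⟨h, hl⟩ | ⟨h, hl⟩⟩ := hc.reverse.exists_lowering_move (by omega)
  · have h := h.reverse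
    rw [List.reverse_reverse] at h
    obtain ⟨v, hv, e⟩ := exists_adj_of_pairMove.1 h
    have h4' := (isConvexOrder_crossings v.2).reversals_quadruples_reverse
    rw [e, List.reverse_reverse, ← e] at h4'
    exact ⟨v, Or.inl ⟨hv, by omega⟩⟩
  · have h := h.reverse
    rw [List.reverse_reverse] at h
    obtain ⟨v, hv, e⟩ := exists_adj_of_pairMove.2 h
    have h3' := (isConvexOrder_crossings v.2).reversals_triples_reverse
    rw [e, List.reverse_reverse, ← e] at h3'
    exact ⟨v, Or.inr ⟨hv, by omega⟩⟩

theorem eq_of_ranks_eq_zero {u v : R (longest n)} (hu : braidRank u = 0 ∧ commRank u = 0)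
    (hv : braidRank v = 0 ∧ commRank v = 0) : u = v :=
  Subtype.ext (crossings_injective 1 ((isConvexOrder_crossings u.2).eq_of_reversals_eq_zero
    (isConvexOrder_crossings v.2) hu.1 hu.2 hv.1 hv.2))

theorem eq_of_ranks_eq_card {u v : R (longest n)}
    (hu : braidRank u = (triples n).card ∧ commRank u = (quadruples n).card)
    (hv : braidRank v = (triples n).card ∧ commRank v = (quadruples n).card) : u = v := by
  have cu := isConvexOrder_crossings u.2
  have cv := isConvexOrder_crossings v.2
  have := cu.reversals_triples_reverse
  have := cu.reversals_quadruples_reverse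
  have := cv.reversals_triples_reverse
  have := cv.reversals_quadruples_reverse
  unfold braidRank commRank at *
  exact Subtype.ext (crossings_injective 1 (List.reverse_injective
    (cu.reverse.eq_of_reversals_eq_zero cv.reverse (by omega) (by omega) (by omega) (by omega))))

theorem exists_isBigrading (n : ℕ) : ∃ r₀ r₁ : R (longest n),
    IsBigrading (commGraph (longest n)) (braidGraph (longest n)) commRank braidRank
      (quadruples n).card (triples n).card r₀ r₁ := by
  obtain ⟨w, hw, ha⟩ := exists_ascending_word n
  have : Nonempty (R (longest n)) := ⟨⟨w, isReducedWord_longest_iff.2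
    ⟨hw, le_antisymm (length_le_of_ascending ha) (choose_two_le_length hw)⟩⟩⟩
  -- A move that lowers or raises one rank keeps the other. An extremum of the sum is therefore
  -- extremal for both ranks at once.
  obtain ⟨r₀, h₀⟩ := Finite.exists_min fun u : R (longest n) => commRank u + braidRank u
  obtain ⟨r₁, h₁⟩ := Finite.exists_max fun u : R (longest n) => commRank u + braidRank u
  have z : braidRank r₀ = 0 ∧ commRank r₀ = 0 := by
    by_contra h
    obtain ⟨v, ⟨e, hv⟩ | ⟨e, hv⟩⟩ := exists_adj_lower r₀ h
    · have := h₀ v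
      have := commGraph_adj_ranks e
      omega
    · have := h₀ v
      have := braidGraph_adj_ranks e
      omega
  have m : braidRank r₁ = (triples n).card ∧ commRank r₁ = (quadruples n).card := by
    by_contra h
    obtain ⟨v, ⟨e, hv⟩ | ⟨e, hv⟩⟩ := exists_adj_raise r₁ h
    · have := h₁ v
      have := commGraph_adj_ranks e
      omega
    · have := h₁ v
      have := braidGraph_adj_ranks e
      omega
  exact ⟨r₀, r₁,
    { le₁ := fun u => reversals_le _ _
      le₂ := fun u => reversals_le _ _
      min₁ := z.2
      min₂ := z.1
      max₁ := m.2
      max₂ := m.1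
      adj₁ := fun u v e => commGraph_adj_ranks e
      adj₂ := fun u v e => braidGraph_adj_ranks e
      lower := fun u hu => exists_adj_lower u fun h => hu (eq_of_ranks_eq_zero h z)
      raise := fun u hu => exists_adj_raise u fun h => hu (eq_of_ranks_eq_card h m) }⟩

theorem graphG_connected_and_diam (n : ℕ) : (graphG (longest n)).Connected ∧
    D n = (quadruples n).card + (triples n).card := by
  obtain ⟨r₀, r₁, h⟩ := exists_isBigrading n
  exact h.sup

theorem graphC_connected_and_diam (n : ℕ) : (graphC (longest n)).Connected ∧
    C n = (triples n).card := by
  obtain ⟨r₀, r₁, h⟩ := exists_isBigrading n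
  exact h.contractAlong

theorem graphB_connected_and_diam (n : ℕ) : (graphB (longest n)).Connected ∧
    B n = (quadruples n).card := by
  obtain ⟨r₀, r₁, h⟩ := exists_isBigrading n
  have := h.swap.contractAlong
  rwa [sup_comm] at this

theorem card_triples_succ (n : ℕ) : (triples (n + 1)).card = (triples n).card + n.choose 2 := by
  rw [card_triples, card_triples, Finset.sum_range_succ]

theorem card_quadruples_succ (n : ℕ) : ((quadruples (n + 1)).card : ℤ) =
    (quadruples n).card + ((n : ℤ) - 2) * (n.choose 2 : ℤ) := by
  rw [card_quadruples, card_quadruples, Finset.sum_range_succ]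
  -- For `n < 2` the factor `n - 2` is truncated in `ℕ` but negative in `ℤ`; the binomial
  -- coefficient is zero there.
  rcases le_or_gt 2 n with h | h
  · push_cast [h]
    ring
  · rw [Nat.choose_eq_zero_of_lt h]
    simp

theorem card_quadruples_add_card_triples (n : ℕ) :
    (((quadruples n).card + (triples n).card : ℕ) : ℚ) =
      (n : ℚ) * ((n : ℚ) - 1) * ((n : ℚ) - 2) * (3 * (n : ℚ) - 5) / 24 := by
  induction n with
  | zero => simp [card_quadruples, card_triples]
  | succ n ih =>
    have h := congrArg (Int.cast : ℤ → ℚ) (card_quadruples_succ n)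
    rw [card_triples_succ]
    push_cast at h ih ⊢
    rw [Nat.cast_choose_two] at *
    linear_combination h + ih

end Longest

end ReducedWords

theorem corollary4p8 :
    -- the graphs are connected, so that their diameters are defined
    (∀ n : ℕ, 1 ≤ n →
      (ReducedWords.graphG (ReducedWords.longest n)).Connected ∧
      (ReducedWords.graphC (ReducedWords.longest n)).Connected ∧
      (ReducedWords.graphB (ReducedWords.longest n)).Connected) ∧
    -- initial values
    (ReducedWords.D 1 = 0 ∧ ReducedWords.C 1 = 0 ∧ ReducedWords.B 1 = 0) ∧
    -- recursions, in `ℤ` so that no subtraction is truncated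
    (∀ n : ℕ, 1 ≤ n →
      (ReducedWords.D (n + 1) : ℤ) = ReducedWords.D n + ((n : ℤ) - 1) * (n.choose 2 : ℤ) ∧
      (ReducedWords.C (n + 1) : ℤ) = ReducedWords.C n + (n.choose 2 : ℤ) ∧
      (ReducedWords.B (n + 1) : ℤ) = ReducedWords.B n + ((n : ℤ) - 2) * (n.choose 2 : ℤ)) ∧
    -- the resulting value of the diameter of `G_{δ_n}`
    (∀ n : ℕ, 1 ≤ n →
      (ReducedWords.D n : ℚ) =
        (n : ℚ) * ((n : ℚ) - 1) * ((n : ℚ) - 2) * (3 * (n : ℚ) - 5) / 24) := by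
  have hD n := (ReducedWords.graphG_connected_and_diam n).2
  have hC n := (ReducedWords.graphC_connected_and_diam n).2
  have hB n := (ReducedWords.graphB_connected_and_diam n).2
  refine ⟨fun n _ => ⟨(ReducedWords.graphG_connected_and_diam n).1,
    (ReducedWords.graphC_connected_and_diam n).1, (ReducedWords.graphB_connected_and_diam n).1⟩,
    ?_, fun n _ => ?_, fun n _ => ?_⟩
  · rw [hD, hC, hB, ReducedWords.card_triples, ReducedWords.card_quadruples]
    simp
  · rw [hD, hD, hC, hC, hB, hB, ReducedWords.card_triples_succ]
    push_cast
    rw [ReducedWords.card_quadruples_succ]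
    exact ⟨by ring, rfl, rfl⟩
  · rw [hD, ReducedWords.card_quadruples_add_card_triples]
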